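/- For a Lebesgue measurable set $E\subset\mathbb R^2$, a Gauss–Green measure of $E$ is an $\mathbb R^2$-valued Borel measure $\mu_E$ on $\mathbb R^2$ such that $\int_E\nabla\varphi\,dx=\int\varphi\,d\mu_E$ for all $\varphi\in C^1_c(\mathbb R^2)$. The set $E$ has finite perimeter if it has such a measure (which is then unique) with $|\mu_E|(\mathbb R^2)<\infty$; its reduced boundary $\partial^*E$ is the set of all $x\in\mathbb R^2$ for which the limit $\lim_{r\to0^+}\mu_E(B_r(x))/|\mu_E|(B_r(x))$ exists and is a unit vector. A set $\Gamma\subset\mathbb R^2$ is lower Ahlfors-regular if there are $r_0,C>0$ such that $\mathcal H^1(\Gamma\cap B_r(x))\ge Cr$ for all $x\in\Gamma$ and $r\in(0,r_0)$. Lemma. Let $\Omega\subset\mathbb R^2$ be a set of finite perimeter such that its topological boundary $\partial\Omega$ is lower Ahlfors-regular and $\mathcal H^1(\partial\Omega\setminus\partial^*\Omega)=0$. Let $A$ and $A'$ be two distinct connected components of $\Omega$. Then no point of $\partial A\cap\partial A'$ belongs to $\partial^*\Omega$. Consequently, $\mathcal H^1(\partial A\cap\partial A')=0$. -/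

import Mathlib

open MeasureTheory Filter Topology

noncomputable section

/-- `μ` is a Gauss-Green measure of `E ⊆ ℝᴺ`: an `ℝᴺ`-valued measure with
`∫_E ∇φ dx = ∫ φ dμ` for every `φ ∈ C¹_c(ℝᴺ)`. -/
def IsGaussGreenMeasure {N : ℕ} (E : Set (EuclideanSpace ℝ (Fin N)))
    (μ : VectorMeasure (EuclideanSpace ℝ (Fin N)) (EuclideanSpace ℝ (Fin N))) : Prop :=
  ∀ φ : EuclideanSpace ℝ (Fin N) → ℝ, ContDiff ℝ 1 φ → HasCompactSupport φ →
    ∫ x in E, gradient φ x = ∫ᵛ x, φ x ∂•μ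

/-- A set of finite perimeter in `ℝᴺ`: a Lebesgue measurable set having a Gauss-Green measure
of finite total variation. -/
def HasFinitePerimeter {N : ℕ} (E : Set (EuclideanSpace ℝ (Fin N))) : Prop :=
  NullMeasurableSet E volume ∧
    ∃ μ : VectorMeasure (EuclideanSpace ℝ (Fin N)) (EuclideanSpace ℝ (Fin N)),
      IsGaussGreenMeasure E μ ∧ μ.variation Set.univ < ⊤

open Classical in
/-- The (unique) Gauss-Green measure of a set of finite perimeter; `0` for any other set. -/
def gaussGreenMeasure {N : ℕ} (E : Set (EuclideanSpace ℝ (Fin N))) :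
    VectorMeasure (EuclideanSpace ℝ (Fin N)) (EuclideanSpace ℝ (Fin N)) :=
  if h : HasFinitePerimeter E then h.2.choose else 0

/-- The reduced boundary `∂*E`: the points `x` at which `μ_E(B_r(x)) / |μ_E|(B_r(x))` converges,
as `r → 0⁺`, to a unit vector. (If `|μ_E|(B_r(x)) = 0` for some `r > 0`, then the quotient below is
`0` for all small `r`, so that `x` is not in the reduced boundary.) -/
def reducedBoundary {N : ℕ} (E : Set (EuclideanSpace ℝ (Fin N))) :
    Set (EuclideanSpace ℝ (Fin N)) :=
  {x | ∃ ν : EuclideanSpace ℝ (Fin N), ‖ν‖ = 1 ∧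
    Tendsto (fun r : ℝ => ((gaussGreenMeasure E).variation.real (Metric.ball x r))⁻¹ •
      gaussGreenMeasure E (Metric.ball x r)) (𝓝[>] 0) (𝓝 ν)}

/-- The lower Ahlfors-regularity estimate for `Γ ⊆ ℝ²`: there are `r₀, C > 0` with
`ℋ¹(Γ ∩ B_r(x)) ≥ C r` for all `r ∈ (0, r₀)` and `x ∈ Γ`. -/
def IsLowerAhlforsRegular (Γ : Set (EuclideanSpace ℝ (Fin 2))) : Prop :=
  ∃ r₀ > (0 : ℝ), ∃ C > (0 : ℝ), ∀ r ∈ Set.Ioo 0 r₀, ∀ x ∈ Γ,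
    ENNReal.ofReal (C * r) ≤ Measure.hausdorffMeasure 1 (Γ ∩ Metric.ball x r)

/-- `A` is a connected component of the set `S`. -/
def IsConnectedComponentOf {X : Type*} [TopologicalSpace X] (A S : Set X) : Prop :=
  ∃ x ∈ S, A = connectedComponentIn S x

end

noncomputable section

open scoped Convolution ENNReal

/-! Suppose `x` is a boundary point of a component of `Ω` and lies in the reduced boundary, with
normal `ν`. The normal points out of `Ω`, since the Gauss–Green measure `μ` is minus the
distributional gradient of the indicator. Write `τ = |μ|` and `θ = τ − ⟨ν, μ⟩`. Convergence of the
averages to a unit vector says exactly that the excess `θ` is negligible with respect to `τ` on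
small balls at `x`. The claim is that every component with `x` in its frontier enters one connected
subset of `Ω`, so that there is only one such component.

Three facts carry this. First, density: at reduced boundary points `τ` has linear growth, and `Ω`
and its complement each fill a fixed fraction of small balls (Sobolev inequality and De Giorgi
iteration, `exists_density_estimates`). By a Vitali covering, lower Ahlfors regularity and the
almost everywhere assumption then give a linear lower bound for `τ` at every point of the boundary
(`exists_le_measure_ball_of_ahlfors`).

Second, flatness: tangential derivatives of the indicator, and derivatives with the wrong sign along
`ν`, are bounded by a measure of size `o(r)` on `B_r(x)`. Joining points by a horizontal and a
vertical segment shows that `Ω` has little area above the tangent line, hence `τ` is small there,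
and the lower density keeps the boundary out of a sector around `ν`
(`IsReducedPoint.exists_no_point_in_sector`). By symmetry the outer sector lies outside `Ω` and the
inner one inside.

Third, columns: if a component accumulates at `x` without meeting the inner sector, then for each
small `s` a vertical line at abscissa `s` or `−s` starts in `Ω`, leaves it, returns to reach the
component and leaves again (`exists_two_frontier_points`). Two reduced boundary points in one column
force upward re-entry into `Ω` or tangential flux, so such columns have measure `o(R)`
(`exists_volume_columns_le`): a contradiction. -/

/-- The Euclidean plane. -/
abbrev Plane := EuclideanSpace ℝ (Fin 2)

/-! ### Scalar components of a Gauss–Green measure -/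

/-- The pairing of a vector measure with a fixed direction, integrated against a bounded function. -/
lemma inner_integral_add_integral_eq {N : ℕ}
    {μ : VectorMeasure (EuclideanSpace ℝ (Fin N)) (EuclideanSpace ℝ (Fin N))}
    [IsFiniteMeasure μ.variation] {e : EuclideanSpace ℝ (Fin N)}
    {σ β : Measure (EuclideanSpace ℝ (Fin N))} [IsFiniteMeasure σ] [IsFiniteMeasure β]
    (h : ∀ S, MeasurableSet S → inner ℝ e (μ S) + β.real S = σ.real S)
    {φ : EuclideanSpace ℝ (Fin N) → ℝ} (hφ : Continuous φ) (hc : HasCompactSupport φ) :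
    inner ℝ e (∫ᵛ x, φ x ∂•μ) + ∫ x, φ x ∂β = ∫ x, φ x ∂σ := by
  have hI : ∀ (m : Measure (EuclideanSpace ℝ (Fin N))) [IsFiniteMeasure m], Integrable φ m :=
    fun m _ => hφ.integrable_of_hasCompactSupport hc
  have hm : Measurable φ := hφ.measurable
  have simple : ∀ f : SimpleFunc (EuclideanSpace ℝ (Fin N)) ℝ,
      inner ℝ e (∫ᵛ x, f x ∂•μ) + ∫ x, f x ∂β = ∫ x, f x ∂σ := by
    intro f
    have hfi : ∀ (m : Measure (EuclideanSpace ℝ (Fin N))) [IsFiniteMeasure m]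
      (f : SimpleFunc (EuclideanSpace ℝ (Fin N)) ℝ), Integrable f m :=
      fun m _ f => SimpleFunc.integrable_of_isFiniteMeasure f
    induction f using SimpleFunc.induction with
    | const c hs =>
      rename_i s
      have h1 : ∫ᵛ x, (SimpleFunc.piecewise s hs (SimpleFunc.const _ c) (SimpleFunc.const _ 0)) x ∂•μ
          = c • μ s := by
        rw [VectorMeasure.integral_eq_setToFun]
        have : ⇑(SimpleFunc.piecewise s hs (SimpleFunc.const (EuclideanSpace ℝ (Fin N)) c)
          (SimpleFunc.const _ 0)) = s.indicator (fun _ => c) := by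
          ext x; simp [Set.indicator, SimpleFunc.piecewise_apply]
        rw [this, setToFun_indicator_const _ hs (measure_ne_top _ _)]
        rfl
      rw [h1]
      have h2 : ∀ (m : Measure (EuclideanSpace ℝ (Fin N))) [IsFiniteMeasure m],
          ∫ x, (SimpleFunc.piecewise s hs (SimpleFunc.const _ c) (SimpleFunc.const _ 0)) x ∂m
          = c * m.real s := by
        intro m _
        have : ⇑(SimpleFunc.piecewise s hs (SimpleFunc.const (EuclideanSpace ℝ (Fin N)) c)
          (SimpleFunc.const _ 0)) = s.indicator (fun _ => c) := by
          ext x; simp [Set.indicator, SimpleFunc.piecewise_apply]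
        rw [this, integral_indicator_const _ hs]
        simp [mul_comm]
      rw [h2, h2, inner_smul_right, ← h s hs]; ring
    | add _ hf hg =>
      rename_i f g _
      rw [SimpleFunc.coe_add]
      rw [VectorMeasure.integral_add (hfi _ _) (hfi _ _), integral_add' (hfi _ _) (hfi _ _),
        integral_add' (hfi _ _) (hfi _ _), inner_add_right, ← hf, ← hg]
      ring
  have t1 : Tendsto (fun n => ∫ᵛ x, (SimpleFunc.approxOn φ hm Set.univ 0 trivial n) x ∂•μ) atTop
      (𝓝 (∫ᵛ x, φ x ∂•μ)) :=
    tendsto_setToFun_approxOn_of_measurable _ (hI _) hm (by simp) _ (integrable_zero _ _ _)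
  have t2 : ∀ (m : Measure (EuclideanSpace ℝ (Fin N))) [IsFiniteMeasure m],
      Tendsto (fun n => ∫ x, (SimpleFunc.approxOn φ hm Set.univ 0 trivial n) x ∂m) atTop
      (𝓝 (∫ x, φ x ∂m)) := by
    intro m _
    simp only [integral_eq_setToFun]
    exact tendsto_setToFun_approxOn_of_measurable _ (hI _) hm (by simp) _ (integrable_zero _ _ _)
  have t3 := ((tendsto_const_nhds (x := e)).inner t1 (𝕜 := ℝ)).add (t2 β)
  simp only [simple] at t3
  exact tendsto_nhds_unique t3 (t2 σ)

/-- A set function `σ - ⟨e, μ⟩` that is nonnegative is a measure. -/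
lemma exists_measure_eq_sub_inner {N : ℕ}
    {μ : VectorMeasure (EuclideanSpace ℝ (Fin N)) (EuclideanSpace ℝ (Fin N))}
    {e : EuclideanSpace ℝ (Fin N)}
    {σ : Measure (EuclideanSpace ℝ (Fin N))} [IsFiniteMeasure σ]
    (h : ∀ S, MeasurableSet S → inner ℝ e (μ S) ≤ σ.real S) :
    ∃ β : Measure (EuclideanSpace ℝ (Fin N)), IsFiniteMeasure β ∧
      ∀ S, MeasurableSet S → inner ℝ e (μ S) + β.real S = σ.real S := by
  set s : SignedMeasure (EuclideanSpace ℝ (Fin N)) := σ.toSignedMeasure -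
    μ.mapRange (innerSL ℝ e).toLinearMap.toAddMonoidHom (innerSL ℝ e).continuous with hs
  have hsa : ∀ S, MeasurableSet S → s S = σ.real S - inner ℝ e (μ S) := by
    intro S hS
    rw [hs, _root_.sub_apply, Measure.toSignedMeasure_apply_measurable hS]
    rfl
  have h0 : 0 ≤[Set.univ] s := by
    refine VectorMeasure.restrict_le_restrict_of_subset_le _ _ fun S hS _ => ?_
    rw [hsa S hS]; simpa using h S hS
  refine ⟨s.toMeasureOfZeroLE Set.univ MeasurableSet.univ h0, inferInstance, fun S hS => ?_⟩
  rw [SignedMeasure.toMeasureOfZeroLE_real_apply s h0 MeasurableSet.univ hS, Set.univ_inter, hsa S hS]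
  ring

/-! ### One-sided derivative bounds for indicator functions -/

/-- The distributional derivative of `1_G` in direction `e` is bounded from one side by the measure
`σ`. -/
def FluxBound (G : Set Plane) (e : Plane) (σ : Measure Plane) : Prop :=
  ∀ φ : Plane → ℝ, ContDiff ℝ 1 φ → HasCompactSupport φ → (∀ x, 0 ≤ φ x) →
    ∫ x in G, fderiv ℝ φ x e ≤ ∫ x, φ x ∂σ

lemma integral_fderiv_apply_eq_inner {E : Set Plane} {μ : VectorMeasure Plane Plane}
    (hμ : IsGaussGreenMeasure E μ) {φ : Plane → ℝ} (h1 : ContDiff ℝ 1 φ) (h2 : HasCompactSupport φ)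
    (e : Plane) : ∫ x in E, fderiv ℝ φ x e = inner ℝ e (∫ᵛ x, φ x ∂•μ) := by
  rw [← hμ φ h1 h2, ← integral_inner]
  · refine integral_congr_ae (Eventually.of_forall fun x => ?_)
    simp only
    rw [real_inner_comm, gradient, InnerProductSpace.toDual_symm_apply]
  · have hc : Continuous (gradient φ) :=
      (InnerProductSpace.toDual ℝ Plane).symm.continuous.comp (h1.continuous_fderiv (by simp))
    have hs : HasCompactSupport (gradient φ) := by
      refine (h2.fderiv (𝕜 := ℝ)).comp_left (g := (InnerProductSpace.toDual ℝ Plane).symm) ?_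
      simp
    exact (hc.integrable_of_hasCompactSupport hs).integrableOn

/-- The deficit `σ − ⟨e, μ⟩` is a positive measure, so its integral against a nonnegative test
function can be dropped. -/
lemma fluxBound_of_le {E : Set Plane} {μ : VectorMeasure Plane Plane} [IsFiniteMeasure μ.variation]
    (hμ : IsGaussGreenMeasure E μ) {e : Plane} {σ : Measure Plane} [IsFiniteMeasure σ]
    (h : ∀ S, MeasurableSet S → inner ℝ e (μ S) ≤ σ.real S) : FluxBound E e σ := by
  intro φ h1 h2 h3
  obtain ⟨β, hβ, hS⟩ := exists_measure_eq_sub_inner h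
  rw [integral_fderiv_apply_eq_inner hμ h1 h2, ← inner_integral_add_integral_eq hS h1.continuous h2]
  linarith [integral_nonneg (μ := β) (f := φ) fun x => h3 x]

lemma integral_fderiv_eq_zero {φ : Plane → ℝ} (h1 : ContDiff ℝ 1 φ) (h2 : HasCompactSupport φ)
    (e : Plane) : ∫ x, fderiv ℝ φ x e = 0 := by
  have := integral_mul_fderiv_eq_neg_fderiv_mul_of_integrable (𝕜 := ℝ) (μ := volume) (f := fun _ : Plane => (1:ℝ))
    (g := φ) (v := e) ?_ ?_ ?_ ?_ ?_
  · simpa using this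
  · simp
  · simp only [one_mul]
    exact ((h1.continuous_fderiv (by simp)).clm_apply continuous_const).integrable_of_hasCompactSupport
      (h2.fderiv_apply (𝕜 := ℝ) e)
  · simpa using h1.continuous.integrable_of_hasCompactSupport h2
  · fun_prop
  · exact fun x _ => h1.differentiable (by simp) x

lemma integrable_fderiv_apply {φ : Plane → ℝ} (h1 : ContDiff ℝ 1 φ) (h2 : HasCompactSupport φ)
    (e : Plane) : Integrable (fun x => fderiv ℝ φ x e) :=
  ((h1.continuous_fderiv (by simp)).clm_apply continuous_const).integrable_of_hasCompactSupport
      (h2.fderiv_apply (𝕜 := ℝ) e)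

lemma setIntegral_compl_fderiv {G : Set Plane} (hG : NullMeasurableSet G) {φ : Plane → ℝ}
    (h1 : ContDiff ℝ 1 φ) (h2 : HasCompactSupport φ) (e : Plane) :
    ∫ x in Gᶜ, fderiv ℝ φ x e = - ∫ x in G, fderiv ℝ φ x e := by
  have := integral_add_compl₀ hG (integrable_fderiv_apply h1 h2 e)
  rw [integral_fderiv_eq_zero h1 h2] at this
  linarith

/-- A directional derivative of a compactly supported function has integral zero, so passing to the
complement only reverses the direction. -/
lemma FluxBound.compl {G : Set Plane} (hG : NullMeasurableSet G) {e : Plane} {σ : Measure Plane}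
    (h : FluxBound G e σ) : FluxBound Gᶜ (-e) σ := by
  intro φ h1 h2 h3
  simpa [setIntegral_compl_fderiv hG h1 h2, integral_neg] using h φ h1 h2 h3

/-! ### A radial test function and its comparison with balls -/

lemma hasDerivAt_max_zero_sq (t : ℝ) : HasDerivAt (fun t : ℝ => (max 0 t) ^ 2) (2 * max 0 t) t := by
  rcases lt_trichotomy t 0 with h | h | h
  · rw [max_eq_left h.le, mul_zero]
    refine (hasDerivAt_const t (0:ℝ)).congr_of_eventuallyEq ?_
    filter_upwards [Iio_mem_nhds h] with s hs
    rw [max_eq_left (le_of_lt hs)]; simp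
  · subst h
    rw [max_self, mul_zero, hasDerivAt_iff_isLittleO_nhds_zero]
    simp only [zero_add, max_self, smul_zero, sub_zero, ne_eq, OfNat.ofNat_ne_zero,
      not_false_eq_true, zero_pow]
    refine Asymptotics.IsBigO.trans_isLittleO (g := fun h : ℝ => h ^ 2) ?_ ?_
    · refine Asymptotics.IsBigO.of_bound 1 (Eventually.of_forall fun x => ?_)
      rw [Real.norm_eq_abs, Real.norm_eq_abs, abs_of_nonneg (sq_nonneg _),
        abs_of_nonneg (sq_nonneg _), one_mul]
      rcases le_total x 0 with hx | hx
      · rw [max_eq_left hx]; nlinarith [sq_nonneg x]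
      · rw [max_eq_right hx]
    · simpa using Asymptotics.isLittleO_pow_pow (𝕜 := ℝ) (m := 1) (n := 2) (by norm_num)
  · rw [max_eq_right h.le]
    have := (hasDerivAt_pow 2 t)
    simp only [Nat.cast_ofNat, Nat.add_one_sub_one, pow_one] at this
    refine this.congr_of_eventuallyEq ?_
    filter_upwards [Ioi_mem_nhds h] with s hs
    rw [max_eq_right (le_of_lt hs)]

/-- A radial `C¹` bump function, decreasing in the distance to `c` and supported in `B_r(c)`. -/
def quadBump (c : Plane) (r : ℝ) (x : Plane) : ℝ := (max 0 (1 - ‖x - c‖ ^ 2 / r ^ 2)) ^ 2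

lemma quadBump_nonneg (c : Plane) (r : ℝ) (x : Plane) : 0 ≤ quadBump c r x := sq_nonneg _

lemma hasFDerivAt_quadBump (c : Plane) (r : ℝ) (x : Plane) :
    HasFDerivAt (quadBump c r)
      ((2 * max 0 (1 - ‖x - c‖ ^ 2 / r ^ 2)) • -((2 / r ^ 2) • innerSL ℝ (x - c))) x := by
  have h1 : HasFDerivAt (fun x : Plane => 1 - ‖x - c‖ ^ 2 / r ^ 2)
      (-((2 / r ^ 2) • innerSL ℝ (x - c))) x := by
    have h2 : HasFDerivAt (fun x : Plane => ‖x - c‖ ^ 2) (2 • innerSL ℝ (x - c)) x := by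
      have h4 := ((hasFDerivAt_id (𝕜 := ℝ) x).sub_const c).norm_sq
      simpa using! h4
    have h3 := (h2.const_mul (1 / r ^ 2)).const_sub 1
    refine (h3.congr_fderiv ?_).congr_of_eventuallyEq (Eventually.of_forall fun y => ?_)
    · ext y
      simp
      ring
    · simp only []; ring
  exact (hasDerivAt_max_zero_sq (1 - ‖x - c‖ ^ 2 / r ^ 2)).comp_hasFDerivAt x h1

lemma contDiff_quadBump (c : Plane) (r : ℝ) : ContDiff ℝ 1 (quadBump c r) := by
  rw [contDiff_one_iff_fderiv]
  refine ⟨fun x => (hasFDerivAt_quadBump c r x).differentiableAt, ?_⟩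
  have : fderiv ℝ (quadBump c r) = fun x =>
      ((2 * max 0 (1 - ‖x - c‖ ^ 2 / r ^ 2)) • -((2 / r ^ 2) • innerSL ℝ (x - c))) :=
    funext fun x => (hasFDerivAt_quadBump c r x).fderiv
  rw [this]
  fun_prop

lemma max_quadBump_eq_zero {c : Plane} {r : ℝ} (hr : 0 < r) {x : Plane} (hx : x ∉ Metric.ball c r) :
    max 0 (1 - ‖x - c‖ ^ 2 / r ^ 2) = 0 := by
  apply max_eq_left
  rw [Metric.mem_ball, not_lt, dist_eq_norm] at hx
  rw [sub_nonpos, one_le_div (by positivity)]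
  gcongr

lemma quadBump_eq_zero {c : Plane} {r : ℝ} (hr : 0 < r) {x : Plane} (hx : x ∉ Metric.ball c r) :
    quadBump c r x = 0 := by
  rw [quadBump, max_quadBump_eq_zero hr hx]; simp

lemma quadBump_le_one (c : Plane) (r : ℝ) (x : Plane) : quadBump c r x ≤ 1 := by
  have : max 0 (1 - ‖x - c‖ ^ 2 / r ^ 2) ≤ 1 := by
    apply max_le zero_le_one
    have : 0 ≤ ‖x - c‖ ^ 2 / r ^ 2 := by positivity
    linarith
  exact pow_le_one₀ (le_max_left _ _) this

lemma hasCompactSupport_quadBump (c : Plane) {r : ℝ} (hr : 0 < r) :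
    HasCompactSupport (quadBump c r) :=
  HasCompactSupport.intro (isCompact_closedBall c r) fun _ hx =>
    quadBump_eq_zero hr fun h => hx (Metric.ball_subset_closedBall h)

lemma fderiv_quadBump_eq_zero {c : Plane} {r : ℝ} (hr : 0 < r) {x : Plane}
    (hx : x ∉ Metric.ball c r) : fderiv ℝ (quadBump c r) x = 0 := by
  rw [(hasFDerivAt_quadBump c r x).fderiv, max_quadBump_eq_zero hr hx]; simp

lemma norm_fderiv_quadBump_le (c : Plane) {r : ℝ} (hr : 0 < r) (x : Plane) :
    ‖fderiv ℝ (quadBump c r) x‖ ≤ 4 / r := by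
  by_cases hx : x ∈ Metric.ball c r
  · rw [(hasFDerivAt_quadBump c r x).fderiv, norm_smul, norm_neg, norm_smul, innerSL_apply_norm]
    rw [Metric.mem_ball, dist_eq_norm] at hx
    have h1 : ‖2 * max 0 (1 - ‖x - c‖ ^ 2 / r ^ 2)‖ ≤ 2 := by
      rw [Real.norm_eq_abs, abs_of_nonneg (by positivity)]
      have : max 0 (1 - ‖x - c‖ ^ 2 / r ^ 2) ≤ 1 := by
        apply max_le zero_le_one
        have : 0 ≤ ‖x - c‖ ^ 2 / r ^ 2 := by positivity
        linarith
      linarith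
    have h2 : ‖2 / r ^ 2‖ * ‖x - c‖ ≤ 2 / r := by
      rw [Real.norm_eq_abs, abs_of_nonneg (by positivity)]
      calc 2 / r ^ 2 * ‖x - c‖ ≤ 2 / r ^ 2 * r := by gcongr
        _ = 2 / r := by field_simp
    calc _ ≤ 2 * (2 / r) := by gcongr
      _ = 4 / r := by ring
  · rw [fderiv_quadBump_eq_zero hr hx, norm_zero]; positivity

lemma le_quadBump {c : Plane} {r s : ℝ} (hr : 0 < r) {x : Plane} (hs : 0 ≤ s) (hsr : s ≤ r)
    (hx : x ∈ Metric.ball c s) : (1 - s ^ 2 / r ^ 2) ^ 2 ≤ quadBump c r x := by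
  rw [Metric.mem_ball, dist_eq_norm] at hx
  have h0 : 0 ≤ 1 - s ^ 2 / r ^ 2 := by
    rw [sub_nonneg, div_le_one (by positivity)]; gcongr
  unfold quadBump
  gcongr
  refine le_trans ?_ (le_max_right _ _)
  gcongr

lemma setIntegral_fderiv_quadBump_le (G : Set Plane) (c : Plane) {r : ℝ} (hr : 0 < r) {e : Plane}
    (he : ‖e‖ ≤ 1) :
    ∫ x in G, fderiv ℝ (quadBump c r) x e ≤ 4 / r * volume.real (G ∩ Metric.ball c r) := by
  have hi := integrable_fderiv_apply (contDiff_quadBump c r) (hasCompactSupport_quadBump c hr) e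
  have hfin : volume (G ∩ Metric.ball c r) ≠ ⊤ :=
    ((measure_mono Set.inter_subset_right).trans_lt measure_ball_lt_top).ne
  have h1 : ∫ x in G, fderiv ℝ (quadBump c r) x e =
      ∫ x in G ∩ Metric.ball c r, fderiv ℝ (quadBump c r) x e := by
    rw [Set.inter_comm, ← Measure.restrict_restrict measurableSet_ball]
    refine (setIntegral_eq_integral_of_forall_compl_eq_zero fun x hx => ?_).symm
    rw [fderiv_quadBump_eq_zero hr hx]; simp
  rw [h1]
  refine (le_abs_self _).trans ?_
  rw [← Real.norm_eq_abs]
  refine norm_setIntegral_le_of_norm_le_const hfin.lt_top fun x _ => ?_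
  refine (ContinuousLinearMap.le_opNorm _ _).trans ?_
  calc _ ≤ 4 / r * 1 := by gcongr; exact norm_fderiv_quadBump_le c hr x
    _ = _ := mul_one _

lemma mul_measure_le_integral_quadBump (τ : Measure Plane) [IsFiniteMeasure τ] (c : Plane) {r s : ℝ}
    (hr : 0 < r) (hs : 0 ≤ s) (hsr : s ≤ r) :
    (1 - s ^ 2 / r ^ 2) ^ 2 * τ.real (Metric.ball c s) ≤ ∫ x, quadBump c r x ∂τ := by
  have hI : Integrable (quadBump c r) τ :=
    (contDiff_quadBump c r).continuous.integrable_of_hasCompactSupport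
      (hasCompactSupport_quadBump c hr)
  calc _ = ∫ _ in Metric.ball c s, (1 - s ^ 2 / r ^ 2) ^ 2 ∂τ := by simp [mul_comm]
    _ ≤ ∫ x in Metric.ball c s, quadBump c r x ∂τ :=
        setIntegral_mono_on (integrable_const _) hI.integrableOn measurableSet_ball
          fun x hx => le_quadBump hr hs hsr hx
    _ ≤ _ := setIntegral_le_integral hI (Eventually.of_forall (quadBump_nonneg c r))

lemma integral_quadBump_le (τ : Measure Plane) [IsFiniteMeasure τ] (c : Plane) {r : ℝ}
    (hr : 0 < r) : ∫ x, quadBump c r x ∂τ ≤ τ.real (Metric.ball c r) := by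
  have hI : Integrable (quadBump c r) τ :=
    (contDiff_quadBump c r).continuous.integrable_of_hasCompactSupport
      (hasCompactSupport_quadBump c hr)
  calc ∫ x, quadBump c r x ∂τ = ∫ x in Metric.ball c r, quadBump c r x ∂τ :=
        (setIntegral_eq_integral_of_forall_compl_eq_zero fun x hx => quadBump_eq_zero hr hx).symm
    _ ≤ ∫ _ in Metric.ball c r, (1:ℝ) ∂τ :=
        setIntegral_mono_on hI.integrableOn (integrable_const _) measurableSet_ball
          fun x _ => quadBump_le_one c r x
    _ = _ := by simp

/-- Superlevel sets of the bump are concentric balls, which is what the layer cake formula needs;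
the radius solves `(1 − ρ²/r²)² = t`. -/
lemma lt_quadBump_iff {c : Plane} {r : ℝ} (hr : 0 < r) {t : ℝ} (ht : 0 ≤ t) (ht1 : t < 1)
    (x : Plane) : t < quadBump c r x ↔ x ∈ Metric.ball c (r * √(1 - √t)) := by
  have hs1 : √t < 1 := by rw [Real.sqrt_lt' one_pos]; simpa
  have h2 : 0 < 1 - √t := by linarith
  have h3 : t < quadBump c r x ↔ ‖x - c‖ ^ 2 / r ^ 2 < 1 - √t := by
    rw [quadBump, ← Real.sqrt_lt_sqrt_iff ht, Real.sqrt_sq (le_max_left _ _), lt_max_iff,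
      or_iff_right (not_lt.2 (Real.sqrt_nonneg t)), lt_sub_comm]
  rw [h3, Metric.mem_ball, dist_eq_norm, div_lt_iff₀ (by positivity)]
  constructor
  · intro h
    refine lt_of_pow_lt_pow_left₀ 2 (by positivity) ?_
    rw [mul_pow, Real.sq_sqrt h2.le]; linarith
  · intro h
    have := pow_lt_pow_left₀ h (norm_nonneg _) two_ne_zero
    rw [mul_pow, Real.sq_sqrt h2.le] at this; linarith

/-- By the layer cake formula both integrals superpose measures of balls about `c` of radius at most
`r`, so a comparison on every such ball passes to the bump. -/
lemma integral_quadBump_le_mul {τ θ : Measure Plane} [IsFiniteMeasure τ] [IsFiniteMeasure θ]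
    {c : Plane} {r k : ℝ} (hr : 0 < r) (hk : 0 ≤ k)
    (h : ∀ s, 0 < s → s ≤ r → θ.real (Metric.ball c s) ≤ k * τ.real (Metric.ball c s)) :
    ∫ x, quadBump c r x ∂θ ≤ k * ∫ x, quadBump c r x ∂τ := by
  have hI : ∀ (m : Measure Plane) [IsFiniteMeasure m], Integrable (quadBump c r) m := fun m _ =>
    (contDiff_quadBump c r).continuous.integrable_of_hasCompactSupport
      (hasCompactSupport_quadBump c hr)
  have h0 : ∀ m : Measure Plane, 0 ≤ᵐ[m] quadBump c r :=
    fun m => Eventually.of_forall (quadBump_nonneg c r)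
  have hlc : ∀ (m : Measure Plane) [IsFiniteMeasure m], ENNReal.ofReal (∫ x, quadBump c r x ∂m) =
      ∫⁻ t in Set.Ioi 0, m {x | t < quadBump c r x} := by
    intro m _
    rw [ofReal_integral_eq_lintegral_ofReal (hI m) (h0 m),
      lintegral_eq_lintegral_meas_lt m (h0 m) (hI m).aemeasurable]
  have hnn : 0 ≤ ∫ x, quadBump c r x ∂τ := integral_nonneg (quadBump_nonneg c r)
  rw [← ENNReal.ofReal_le_ofReal_iff (by positivity), ENNReal.ofReal_mul hk, hlc, hlc,
    ← lintegral_const_mul' _ _ ENNReal.ofReal_ne_top]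
  refine setLIntegral_mono' measurableSet_Ioi fun t ht => ?_
  rcases lt_or_ge t 1 with h1 | h1
  · have hset : {x | t < quadBump c r x} = Metric.ball c (r * √(1 - √t)) :=
      Set.ext fun x => lt_quadBump_iff hr (le_of_lt ht) h1 x
    have hs1 : √t < 1 := by rw [Real.sqrt_lt' one_pos]; simpa
    have h2 : 0 < √(1 - √t) := Real.sqrt_pos.2 (by linarith)
    have h3 : √(1 - √t) ≤ 1 := by
      rw [Real.sqrt_le_left (by norm_num)]; linarith [Real.sqrt_nonneg t]
    have h4 := h (r * √(1 - √t)) (by positivity) (mul_le_of_le_one_right hr.le h3)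
    rw [hset, ← ENNReal.ofReal_toReal (measure_ne_top θ _), ← ENNReal.ofReal_toReal
      (measure_ne_top τ _), ← ENNReal.ofReal_mul hk]
    exact ENNReal.ofReal_le_ofReal h4
  · have hset : {x | t < quadBump c r x} = ∅ :=
      Set.eq_empty_of_forall_notMem fun x hx =>
        absurd (lt_of_lt_of_le hx (quadBump_le_one c r x)) (not_lt.2 h1)
    rw [hset]; simp

/-- Control of the total variation near a point by the volume fraction of `G`. -/
lemma integral_quadBump_le_volume {G : Set Plane} {τ θ : Measure Plane} [IsFiniteMeasure τ]
    [IsFiniteMeasure θ] {c ν : Plane} {r : ℝ} (hr : 0 < r) (hν : ‖ν‖ ≤ 1)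
    (hG : ∫ x, quadBump c r x ∂τ ≤ ∫ x, quadBump c r x ∂θ + ∫ x in G, fderiv ℝ (quadBump c r) x ν)
    (h : ∀ s, 0 < s → s ≤ r → θ.real (Metric.ball c s) ≤ 1 / 2 * τ.real (Metric.ball c s)) :
    ∫ x, quadBump c r x ∂τ ≤ 8 / r * volume.real (G ∩ Metric.ball c r) := by
  -- The `θ` term is at most half of the left side and is absorbed; this doubles the constant `4 /
  -- r`.
  have h1 := integral_quadBump_le_mul hr (by norm_num) h
  have h2 := setIntegral_fderiv_quadBump_le G c hr hν
  have h3 : 8 / r = 2 * (4 / r) := by ring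
  rw [h3]
  linarith

/-! ### Mollification and the Sobolev inequality on `G` -/

/-- Mollification of the function `1_G φ`. -/
def mollify (k : ContDiffBump (0 : Plane)) (G : Set Plane) (φ : Plane → ℝ) : Plane → ℝ :=
  (k.normed volume ⋆[ContinuousLinearMap.lsmul ℝ ℝ, volume] (G.indicator φ))

lemma locallyIntegrable_indicator_of_continuous {G : Set Plane} (hG : MeasurableSet G)
    {φ : Plane → ℝ} (hφ : Continuous φ) : LocallyIntegrable (G.indicator φ) :=
  hφ.locallyIntegrable.indicator hG

lemma contDiff_mollify (k : ContDiffBump (0 : Plane)) {G : Set Plane} (hG : MeasurableSet G)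
    {φ : Plane → ℝ} (hφ : Continuous φ) : ContDiff ℝ 1 (mollify k G φ) :=
  k.hasCompactSupport_normed.contDiff_convolution_left (n := 1) _ k.contDiff_normed
    (locallyIntegrable_indicator_of_continuous hG hφ)

lemma fderiv_mollify_apply (k : ContDiffBump (0 : Plane)) {G : Set Plane} (hG : MeasurableSet G)
    {φ : Plane → ℝ} (hφ : Continuous φ) (x e : Plane) :
    fderiv ℝ (mollify k G φ) x e = ∫ y in G, fderiv ℝ (k.normed volume) (x - y) e * φ y := by
  have hl := locallyIntegrable_indicator_of_continuous hG hφ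
  have hk : ContDiff ℝ 1 (k.normed (volume : Measure Plane)) := k.contDiff_normed
  have h1 := k.hasCompactSupport_normed.hasFDerivAt_convolution_left
    (ContinuousLinearMap.lsmul ℝ ℝ) hk hl x
  rw [mollify, h1.fderiv, convolution_eq_swap, ContinuousLinearMap.integral_apply,
    ← integral_indicator hG]
  · refine integral_congr_ae (Eventually.of_forall fun y => ?_)
    by_cases hy : y ∈ G <;> simp [hy, ContinuousLinearMap.precompL_apply]
  · have := (k.hasCompactSupport_normed.fderiv (𝕜 := ℝ)).convolutionExists_left
      ((ContinuousLinearMap.lsmul ℝ ℝ).precompL Plane) (hk.continuous_fderiv (by simp)) hl x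
    exact this.integrable_swap

lemma contDiff_normed_sub (k : ContDiffBump (0 : Plane)) (x : Plane) :
    ContDiff ℝ 1 (fun y => k.normed volume (x - y)) :=
  (k.contDiff_normed (n := 1)).comp (contDiff_const.sub contDiff_id)

lemma hasCompactSupport_normed_sub (k : ContDiffBump (0 : Plane)) (x : Plane) :
    HasCompactSupport (fun y => k.normed volume (x - y)) :=
  k.hasCompactSupport_normed.comp_homeomorph (Homeomorph.subLeft x)

/-- Test the flux bound with `y ↦ k(x − y) φ(y)`: differentiating the kernel in `x` is minus
differentiating it in `y`, and the product rule leaves the term with the derivative of `φ`. -/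
lemma fderiv_mollify_apply_le (k : ContDiffBump (0 : Plane)) {G : Set Plane} (hG : MeasurableSet G)
    {e : Plane} {σ : Measure Plane} (hσ : FluxBound G (-e) σ)
    {φ : Plane → ℝ} (hφ : ContDiff ℝ 1 φ) (h0 : ∀ x, 0 ≤ φ x) (x : Plane) :
    fderiv ℝ (mollify k G φ) x e ≤ ∫ y, k.normed volume (x - y) * φ y ∂σ +
      ∫ y in G, k.normed volume (x - y) * fderiv ℝ φ y e := by
  have hk := contDiff_normed_sub k x
  have hs := hasCompactSupport_normed_sub k x
  have h1 := hσ (fun y => k.normed volume (x - y) * φ y) (hk.mul hφ) hs.mul_right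
    (fun y => mul_nonneg (k.nonneg_normed _) (h0 y))
  have hd : ∀ y, fderiv ℝ (fun y => k.normed volume (x - y) * φ y) y (-e) =
      fderiv ℝ (k.normed volume) (x - y) e * φ y - k.normed volume (x - y) * fderiv ℝ φ y e := by
    intro y
    have e1 : HasFDerivAt (fun y => k.normed volume (x - y))
        ((fderiv ℝ (k.normed volume) (x - y)).comp (-ContinuousLinearMap.id ℝ Plane)) y := by
      have a1 : HasFDerivAt (k.normed volume) (fderiv ℝ (k.normed volume) (x - y)) (x - y) :=
        ((k.contDiff_normed (n := 1)).differentiable (by simp) _).hasFDerivAt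
      exact a1.comp y ((hasFDerivAt_id y).const_sub x)
    have e2 := (hφ.differentiable (by simp) y).hasFDerivAt
    have e3 : HasFDerivAt (fun y => k.normed volume (x - y) * φ y) _ y := e1.mul e2
    rw [e3.fderiv]
    simp
    ring
  simp only [hd] at h1
  rw [integral_sub] at h1
  · rw [fderiv_mollify_apply k hG hφ.continuous]; linarith
  · refine Integrable.integrableOn (Continuous.integrable_of_hasCompactSupport ?_ ?_)
    · have := (k.contDiff_normed (μ := (volume : Measure Plane)) (n := 1)).continuous_fderiv (by simp)
      have hc := hφ.continuous
      exact ((this.comp (continuous_const.sub continuous_id)).clm_apply continuous_const).mul hc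
    · refine HasCompactSupport.mul_right ?_
      exact ((k.hasCompactSupport_normed (μ := (volume : Measure Plane))).fderiv_apply (𝕜 := ℝ) e).comp_homeomorph (Homeomorph.subLeft x)
  · refine Integrable.integrableOn (Continuous.integrable_of_hasCompactSupport ?_ hs.mul_right)
    exact hk.continuous.mul ((hφ.continuous_fderiv (by simp)).clm_apply continuous_const)

lemma lintegral_normed_sub (k : ContDiffBump (0 : Plane)) (y : Plane) :
    ∫⁻ x, ENNReal.ofReal (k.normed volume (x - y)) = 1 := by
  rw [lintegral_sub_right_eq_self (fun x => ENNReal.ofReal (k.normed volume x)) y,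
    ← ofReal_integral_eq_lintegral_ofReal k.integrable_normed
      (Eventually.of_forall k.nonneg_normed), k.integral_normed, ENNReal.ofReal_one]

lemma normed_sub_eq_zero (k : ContDiffBump (0 : Plane)) {x y : Plane}
    (h : y ∉ Metric.ball x k.rOut) : k.normed volume (x - y) = 0 := by
  rw [← Function.notMem_support, k.support_normed_eq]
  simpa [dist_eq_norm, norm_sub_rev] using h

lemma measurable_ofReal_normed_sub (k : ContDiffBump (0 : Plane)) :
    Measurable (fun p : Plane × Plane => ENNReal.ofReal (k.normed volume (p.1 - p.2))) := by
  have : Continuous (fun p : Plane × Plane => k.normed volume (p.1 - p.2)) :=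
    k.continuous_normed.comp (by fun_prop)
  exact this.measurable.ennreal_ofReal

lemma measurable_ofReal_normed_sub_left (k : ContDiffBump (0 : Plane)) (y : Plane) :
    Measurable (fun x : Plane => ENNReal.ofReal (k.normed volume (x - y))) := by
  have : Continuous (fun x : Plane => k.normed volume (x - y)) :=
    k.continuous_normed.comp (by fun_prop)
  exact this.measurable.ennreal_ofReal

/-- Directional derivatives of mollified indicators, integrated over a set. -/
lemma setLIntegral_fderiv_mollify_one_le (k : ContDiffBump (0 : Plane)) {G : Set Plane}
    (hG : MeasurableSet G) {e : Plane} {σ : Measure Plane} [IsFiniteMeasure σ]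
    (hσ : FluxBound G (-e) σ)
    {S U : Set Plane} (hU : MeasurableSet U) (hSU : ∀ x ∈ S, Metric.ball x k.rOut ⊆ U)
    (hS : MeasurableSet S) :
    ∫⁻ x in S, ENNReal.ofReal (fderiv ℝ (mollify k G fun _ => 1) x e) ≤ σ U := by
  have h1 : ∀ x, ENNReal.ofReal (fderiv ℝ (mollify k G fun _ => 1) x e) ≤
      ∫⁻ y, ENNReal.ofReal (k.normed volume (x - y)) ∂σ := by
    intro x
    have := fderiv_mollify_apply_le k hG hσ (φ := fun _ => 1) contDiff_const (by simp) x
    simp only [mul_one, fderiv_fun_const, Pi.zero_apply, _root_.zero_apply, mul_zero,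
      integral_zero, add_zero] at this
    rw [← ofReal_integral_eq_lintegral_ofReal]
    · exact ENNReal.ofReal_le_ofReal this
    · exact (contDiff_normed_sub k x).continuous.integrable_of_hasCompactSupport
        (hasCompactSupport_normed_sub k x)
    · exact Eventually.of_forall fun y => k.nonneg_normed _
  calc _ ≤ ∫⁻ x in S, ∫⁻ y, ENNReal.ofReal (k.normed volume (x - y)) ∂σ :=
        lintegral_mono fun x => h1 x
    _ = ∫⁻ y, (∫⁻ x in S, ENNReal.ofReal (k.normed volume (x - y))) ∂σ :=
        lintegral_lintegral_swap (measurable_ofReal_normed_sub k).aemeasurable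
    -- A point `y` receives kernel mass at most `1`, and none from `S` when `y` lies outside `U`.
    _ ≤ ∫⁻ y, U.indicator 1 y ∂σ := by
        refine lintegral_mono fun y => ?_
        by_cases hy : y ∈ U
        · simp only [hy, Set.indicator_of_mem, Pi.one_apply]
          exact (setLIntegral_le_lintegral _ _).trans (lintegral_normed_sub k y).le
        · simp only [hy, not_false_eq_true, Set.indicator_of_notMem, nonpos_iff_eq_zero]
          rw [setLIntegral_eq_zero_iff hS]
          · refine Eventually.of_forall fun x hx => ?_
            rw [normed_sub_eq_zero k fun h => hy (hSU x hx h), ENNReal.ofReal_zero]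
          · exact measurable_ofReal_normed_sub_left k y
    _ = σ U := by rw [lintegral_indicator_one hU]

/-- The total variation of the distributional gradient of `1_G` is at most the measure `τ`. -/
def VariationBound (G : Set Plane) (τ : Measure Plane) : Prop :=
  ∀ e : Plane, ‖e‖ = 1 → FluxBound G e τ

lemma VariationBound.compl {G : Set Plane} (hG : MeasurableSet G) {τ : Measure Plane}
    (h : VariationBound G τ) : VariationBound Gᶜ τ := by
  intro e he
  simpa using (h (-e) (by simpa)).compl hG.nullMeasurableSet

/-- A one-sided bound valid in all unit directions, hence for `e` and `-e`, is a bound on the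
operator norm. -/
lemma enorm_fderiv_mollify_le (k : ContDiffBump (0 : Plane)) {G : Set Plane} (hG : MeasurableSet G)
    {τ : Measure Plane} [IsFiniteMeasure τ] (hτ : VariationBound G τ)
    {φ : Plane → ℝ} (hφ : ContDiff ℝ 1 φ) (h0 : ∀ x, 0 ≤ φ x) (x : Plane) :
    ‖fderiv ℝ (mollify k G φ) x‖ₑ ≤
      ∫⁻ y, ENNReal.ofReal (k.normed volume (x - y)) * ENNReal.ofReal (φ y) ∂τ +
      ∫⁻ y in G, ENNReal.ofReal (k.normed volume (x - y)) * ‖fderiv ℝ φ y‖ₑ := by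
  have hk := contDiff_normed_sub k x
  have hs := hasCompactSupport_normed_sub k x
  have i1 : Integrable (fun y => k.normed volume (x - y) * φ y) τ :=
    (hk.continuous.mul hφ.continuous).integrable_of_hasCompactSupport hs.mul_right
  have i2 : ∀ e, IntegrableOn (fun y => k.normed volume (x - y) * fderiv ℝ φ y e) G := fun e =>
    ((hk.continuous.mul ((hφ.continuous_fderiv (by simp)).clm_apply
      continuous_const)).integrable_of_hasCompactSupport hs.mul_right).integrableOn
  have i3 : IntegrableOn (fun y => k.normed volume (x - y) * ‖fderiv ℝ φ y‖) G :=
    ((hk.continuous.mul (hφ.continuous_fderiv (by simp)).norm).integrable_of_hasCompactSupport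
      hs.mul_right).integrableOn
  have key : ∀ e : Plane, ‖e‖ = 1 → fderiv ℝ (mollify k G φ) x e ≤
      ∫ y, k.normed volume (x - y) * φ y ∂τ +
      ∫ y in G, k.normed volume (x - y) * ‖fderiv ℝ φ y‖ := by
    intro e he
    refine (fderiv_mollify_apply_le k hG (hτ (-e) (by simpa)) hφ h0 x).trans ?_
    gcongr
    · exact i2 e
    · exact hG.nullMeasurableSet
    · exact k.nonneg_normed _
    · rename_i y _
      refine (le_abs_self _).trans ?_
      have := (fderiv ℝ φ y).le_opNorm e
      rwa [he, mul_one] at this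
  have n1 : 0 ≤ ∫ y, k.normed volume (x - y) * φ y ∂τ :=
    integral_nonneg fun y => mul_nonneg (k.nonneg_normed _) (h0 y)
  have n2 : 0 ≤ ∫ y in G, k.normed volume (x - y) * ‖fderiv ℝ φ y‖ :=
    integral_nonneg fun y => mul_nonneg (k.nonneg_normed _) (norm_nonneg _)
  have hn : ‖fderiv ℝ (mollify k G φ) x‖ ≤ ∫ y, k.normed volume (x - y) * φ y ∂τ +
      ∫ y in G, k.normed volume (x - y) * ‖fderiv ℝ φ y‖ := by
    refine ContinuousLinearMap.opNorm_le_of_unit_norm (by positivity) fun e he => ?_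
    rw [Real.norm_eq_abs, abs_le]
    constructor
    · have := key (-e) (by simpa)
      rw [map_neg] at this; linarith
    · exact key e he
  rw [← ofReal_norm]
  refine (ENNReal.ofReal_le_ofReal hn).trans ?_
  rw [ENNReal.ofReal_add n1 n2, ofReal_integral_eq_lintegral_ofReal i1,
    ofReal_integral_eq_lintegral_ofReal i3]
  · simp only [ENNReal.ofReal_mul (k.nonneg_normed _), ofReal_norm]; exact le_rfl
  · exact Eventually.of_forall fun y => mul_nonneg (k.nonneg_normed _) (norm_nonneg _)
  · exact Eventually.of_forall fun y => mul_nonneg (k.nonneg_normed _) (h0 y)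

lemma lintegral_fderiv_mollify_le (k : ContDiffBump (0 : Plane)) {G : Set Plane}
    (hG : MeasurableSet G)
    {τ : Measure Plane} [IsFiniteMeasure τ] (hτ : VariationBound G τ)
    {φ : Plane → ℝ} (hφ : ContDiff ℝ 1 φ) (h0 : ∀ x, 0 ≤ φ x) :
    ∫⁻ x, ‖fderiv ℝ (mollify k G φ) x‖ₑ ≤
      ∫⁻ y, ENNReal.ofReal (φ y) ∂τ + ∫⁻ y in G, ‖fderiv ℝ φ y‖ₑ := by
  have m1 : Measurable fun y => ENNReal.ofReal (φ y) := hφ.continuous.measurable.ennreal_ofReal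
  have m2 : Measurable fun y => ‖fderiv ℝ φ y‖ₑ := (hφ.continuous_fderiv (by simp)).measurable.enorm
  have hmk := measurable_ofReal_normed_sub k
  have tonelli : ∀ (m : Measure Plane) [SFinite m] (g : Plane → ℝ≥0∞), Measurable g →
      ∫⁻ x, ∫⁻ y, ENNReal.ofReal (k.normed volume (x - y)) * g y ∂m = ∫⁻ y, g y ∂m := by
    intro m _ g hg
    rw [lintegral_lintegral_swap (hmk.mul (hg.comp measurable_snd)).aemeasurable]
    refine lintegral_congr fun y => ?_
    rw [lintegral_mul_const _ (f := fun x => ENNReal.ofReal (k.normed volume (x - y)))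
      (measurable_ofReal_normed_sub_left k y), lintegral_normed_sub, one_mul]
  calc _ ≤ ∫⁻ x, (∫⁻ y, ENNReal.ofReal (k.normed volume (x - y)) * ENNReal.ofReal (φ y) ∂τ +
      ∫⁻ y in G, ENNReal.ofReal (k.normed volume (x - y)) * ‖fderiv ℝ φ y‖ₑ) :=
        lintegral_mono fun x => enorm_fderiv_mollify_le k hG hτ hφ h0 x
    _ = _ := by
      rw [lintegral_add_left, tonelli _ _ m1, tonelli _ _ m2]
      exact (hmk.mul (m1.comp measurable_snd)).lintegral_prod_right'

/-- A sequence of mollifying kernels concentrating at the origin. -/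
def kernelSeq (n : ℕ) : ContDiffBump (0 : Plane) where
  rIn := 1 / (n + 1)
  rOut := 2 / (n + 1)
  rIn_pos := by positivity
  rIn_lt_rOut := by gcongr; norm_num

lemma tendsto_kernelSeq_rOut : Tendsto (fun n => (kernelSeq n).rOut) atTop (𝓝 0) := by
  have := (tendsto_one_div_add_atTop_nhds_zero_nat (𝕜 := ℝ)).const_mul 2
  simpa [kernelSeq, div_eq_mul_inv] using this

lemma ae_tendsto_mollify {G : Set Plane} (hG : MeasurableSet G) {φ : Plane → ℝ}
    (hφ : Continuous φ) :
    ∀ᵐ x, Tendsto (fun n => mollify (kernelSeq n) G φ x) atTop (𝓝 (G.indicator φ x)) :=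
  ContDiffBump.ae_convolution_tendsto_right_of_locallyIntegrable (K := 2) tendsto_kernelSeq_rOut
    -- The bounded ratio `rOut = 2 rIn` is what makes Lebesgue differentiation apply.
    (Eventually.of_forall fun n => by simp only [kernelSeq]; exact le_of_eq (by ring))
    (locallyIntegrable_indicator_of_continuous hG hφ)

/-- Gagliardo-Nirenberg-Sobolev inequality for `1_G φ`. -/
lemma exists_setLIntegral_sq_le : ∃ C : NNReal, ∀ (G : Set Plane) (τ : Measure Plane) (φ : Plane → ℝ),
    MeasurableSet G → IsFiniteMeasure τ → VariationBound G τ → ContDiff ℝ 1 φ →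
    HasCompactSupport φ → (∀ x, 0 ≤ φ x) →
    ∫⁻ x in G, ENNReal.ofReal (φ x) ^ (2:ℝ) ≤
      C * (∫⁻ y, ENNReal.ofReal (φ y) ∂τ + ∫⁻ y in G, ‖fderiv ℝ φ y‖ₑ) ^ (2:ℝ) := by
  -- The critical exponent `n / (n − 1)` equals `2` in the plane.
  have hp : Real.HolderConjugate (Module.finrank ℝ Plane) (2:ℝ) := by
    simp only [finrank_euclideanSpace, Fintype.card_fin, Nat.cast_ofNat]
    exact Real.HolderConjugate.two_two
  refine ⟨lintegralPowLePowLIntegralFDerivConst (volume : Measure Plane) 2, ?_⟩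
  intro G τ φ hG _ hτ hφ hc h0
  have hn : ∀ n, ∫⁻ x, ‖mollify (kernelSeq n) G φ x‖ₑ ^ (2:ℝ) ≤
      lintegralPowLePowLIntegralFDerivConst (volume : Measure Plane) 2 *
      (∫⁻ y, ENNReal.ofReal (φ y) ∂τ + ∫⁻ y in G, ‖fderiv ℝ φ y‖ₑ) ^ (2:ℝ) := by
    intro n
    have hsup : HasCompactSupport (mollify (kernelSeq n) G φ) :=
      (kernelSeq n).hasCompactSupport_normed.convolution _ (hc.mono (by simp [Set.support_indicator]))
    refine (lintegral_pow_le_pow_lintegral_fderiv volume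
      (contDiff_mollify (kernelSeq n) hG hφ.continuous) hsup hp).trans ?_
    gcongr
    exact lintegral_fderiv_mollify_le _ hG hτ hφ h0
  calc ∫⁻ x in G, ENNReal.ofReal (φ x) ^ (2:ℝ) = ∫⁻ x, ‖G.indicator φ x‖ₑ ^ (2:ℝ) := by
        rw [← lintegral_indicator hG]
        refine lintegral_congr fun x => ?_
        by_cases hx : x ∈ G
        · simp [hx, Real.enorm_of_nonneg (h0 x)]
        · simp [hx]
    -- Almost everywhere convergence and Fatou transfer the bound, which is uniform in `n`.
    _ ≤ ∫⁻ x, liminf (fun n => ‖mollify (kernelSeq n) G φ x‖ₑ ^ (2:ℝ)) atTop := by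
        refine lintegral_mono_ae ?_
        filter_upwards [ae_tendsto_mollify hG hφ.continuous] with x hx
        exact (((ENNReal.continuous_rpow_const.comp continuous_enorm).tendsto _).comp hx).liminf_eq.ge
    _ ≤ liminf (fun n => ∫⁻ x, ‖mollify (kernelSeq n) G φ x‖ₑ ^ (2:ℝ)) atTop := by
        refine lintegral_liminf_le fun n => ?_
        exact ((contDiff_mollify (kernelSeq n) hG hφ.continuous).continuous.measurable.enorm).pow_const _
    _ ≤ _ := by
        refine (liminf_le_liminf (Eventually.of_forall hn)).trans ?_
        simp

/-! ### Lower volume density by De Giorgi iteration -/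

lemma volume_inter_ball_ne_top (G : Set Plane) (x : Plane) (r : ℝ) :
    volume (G ∩ Metric.ball x r) ≠ ⊤ :=
  ((measure_mono Set.inter_subset_right).trans_lt measure_ball_lt_top).ne

/-- Apply the Sobolev inequality to `1_G` times the bump. The `τ` term and the gradient term
contribute `8 / r` and `4 / r` times the volume of `G` in `B_r`, whence `144 = 12²`; the volume on
the smaller ball is thus quadratic in that on the larger one. -/
lemma exists_volume_ball_step : ∃ K > (0:ℝ), ∀ (G : Set Plane) (τ : Measure Plane) (x : Plane)
    (r s : ℝ), MeasurableSet G → IsFiniteMeasure τ → VariationBound G τ → 0 < r → 0 ≤ s → s ≤ r →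
    ∫ y, quadBump x r y ∂τ ≤ 8 / r * volume.real (G ∩ Metric.ball x r) →
    (1 - s ^ 2 / r ^ 2) ^ 4 * volume.real (G ∩ Metric.ball x s) ≤
      K * (volume.real (G ∩ Metric.ball x r) / r) ^ 2 := by
  obtain ⟨C, hC⟩ := exists_setLIntegral_sq_le
  refine ⟨(C + 1) * 144, by positivity, ?_⟩
  intro G τ x r s hG hτ hv hr hs hsr hle
  set m := volume.real (G ∩ Metric.ball x r) with hm
  have hφ := contDiff_quadBump x r
  have hφc := hasCompactSupport_quadBump x hr
  have h := hC G τ (quadBump x r) hG hτ hv hφ hφc (quadBump_nonneg x r)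
  have h1 : ∫⁻ y, ENNReal.ofReal (quadBump x r y) ∂τ ≤ ENNReal.ofReal (8 / r * m) := by
    rw [← ofReal_integral_eq_lintegral_ofReal (hφ.continuous.integrable_of_hasCompactSupport hφc)
      (Eventually.of_forall (quadBump_nonneg x r))]
    exact ENNReal.ofReal_le_ofReal hle
  have h2 : ∫⁻ y in G, ‖fderiv ℝ (quadBump x r) y‖ₑ ≤ ENNReal.ofReal (4 / r * m) := by
    calc _ ≤ ∫⁻ y in G, (Metric.ball x r).indicator (fun _ => ENNReal.ofReal (4 / r)) y := by
          refine lintegral_mono fun y => ?_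
          by_cases hy : y ∈ Metric.ball x r
          · rw [Set.indicator_of_mem hy, ← ofReal_norm]
            exact ENNReal.ofReal_le_ofReal (norm_fderiv_quadBump_le x hr y)
          · rw [Set.indicator_of_notMem hy, ← ofReal_norm, fderiv_quadBump_eq_zero hr hy, norm_zero,
              ENNReal.ofReal_zero]
      _ = ENNReal.ofReal (4 / r) * volume (G ∩ Metric.ball x r) := by
          rw [lintegral_indicator_const measurableSet_ball, Measure.restrict_apply measurableSet_ball,
            Set.inter_comm]
      _ = _ := by
          rw [ENNReal.ofReal_mul (by positivity), hm, measureReal_def,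
            ENNReal.ofReal_toReal (volume_inter_ball_ne_top G x r)]
  have h0 : 0 ≤ 1 - s ^ 2 / r ^ 2 := by
    rw [sub_nonneg, div_le_one (by positivity)]; gcongr
  have h3 : ENNReal.ofReal ((1 - s ^ 2 / r ^ 2) ^ 4 * volume.real (G ∩ Metric.ball x s)) ≤
      ∫⁻ y in G, ENNReal.ofReal (quadBump x r y) ^ (2:ℝ) := by
    calc _ = ∫⁻ y in G, (Metric.ball x s).indicator
          (fun _ => ENNReal.ofReal ((1 - s ^ 2 / r ^ 2) ^ 4)) y := by
          rw [lintegral_indicator_const measurableSet_ball, Measure.restrict_apply measurableSet_ball,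
            ENNReal.ofReal_mul (by positivity), measureReal_def,
            ENNReal.ofReal_toReal (volume_inter_ball_ne_top G x s), Set.inter_comm]
      _ ≤ _ := by
          refine lintegral_mono fun y => ?_
          by_cases hy : y ∈ Metric.ball x s
          · rw [Set.indicator_of_mem hy, ENNReal.ofReal_rpow_of_nonneg (quadBump_nonneg x r y)
              (by norm_num)]
            apply ENNReal.ofReal_le_ofReal
            have := le_quadBump hr hs hsr hy
            calc (1 - s ^ 2 / r ^ 2) ^ 4 = ((1 - s ^ 2 / r ^ 2) ^ 2) ^ 2 := by ring
              _ ≤ quadBump x r y ^ 2 := by gcongr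
              _ = _ := by simp
          · simp [hy]
  have h4 := h3.trans (h.trans (show _ ≤ (C:ℝ≥0∞) * (ENNReal.ofReal (8 / r * m) +
    ENNReal.ofReal (4 / r * m)) ^ (2:ℝ) by gcongr))
  have hm0 : 0 ≤ m := measureReal_nonneg
  rw [← ENNReal.ofReal_add (by positivity) (by positivity),
    ENNReal.ofReal_rpow_of_nonneg (by positivity) (by norm_num),
    ← ENNReal.ofReal_coe_nnreal, ← ENNReal.ofReal_mul (by positivity),
    ENNReal.ofReal_le_ofReal_iff (by positivity)] at h4
  refine h4.trans ?_
  have : (8 / r * m + 4 / r * m) ^ (2:ℝ) = 144 * (m / r) ^ 2 := by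
    rw [Real.rpow_two]; ring
  rw [this, mul_assoc]
  gcongr
  linarith

/-- The bound `a k ≤ 16⁻ᵏ / (16 L)` reproduces itself: squaring gains `16⁻²ᵏ` against a loss of
`16ᵏ`, and the initial smallness supplies the remaining factor `1 / 16`. -/
lemma tendsto_zero_of_sq_iteration {a : ℕ → ℝ} {L : ℝ} (hL : 0 < L) (h0 : ∀ k, 0 ≤ a k)
    (ha : ∀ k, a (k + 1) ≤ L * 16 ^ k * a k ^ 2) (ha0 : a 0 ≤ 1 / (16 * L)) :
    Tendsto a atTop (𝓝 0) := by
  have hb : ∀ k, a k ≤ 1 / (16 * L) * (1 / 16) ^ k := by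
    intro k
    induction k with
    | zero => simpa using ha0
    | succ k ih =>
      have h16 : (0:ℝ) < 16 ^ k := by positivity
      calc a (k + 1) ≤ L * 16 ^ k * a k ^ 2 := ha k
        _ ≤ L * 16 ^ k * (1 / (16 * L) * (1 / 16) ^ k) ^ 2 := by
            gcongr; exact h0 k
        _ = _ := by rw [one_div_pow, one_div_pow, pow_succ 16]; field_simp
  refine squeeze_zero h0 hb ?_
  have := (tendsto_pow_atTop_nhds_zero_of_lt_one (r := (1/16:ℝ)) (by norm_num) (by norm_num)).const_mul
    (1 / (16 * L))
  simpa using this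

/-- Lower density estimate for the volume. -/
lemma exists_le_volume_ball : ∃ c > (0:ℝ), ∀ (G : Set Plane) (τ : Measure Plane) (x : Plane)
    (R : ℝ), MeasurableSet G → IsFiniteMeasure τ → VariationBound G τ → 0 < R →
    (∀ r, 0 < r → r ≤ R →
      ∫ y, quadBump x r y ∂τ ≤ 8 / r * volume.real (G ∩ Metric.ball x r)) →
    (∀ r > 0, 0 < τ.real (Metric.ball x r)) →
    c * R ^ 2 ≤ volume.real (G ∩ Metric.ball x R) := by
  obtain ⟨K, hK, hstep⟩ := exists_volume_ball_step
  refine ⟨1 / (16 * (1024 * K)), by positivity, ?_⟩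
  intro G τ x R hG hτ hv hR hle hpos
  by_contra! hlt
  -- Radii decrease from `R` towards `R / 2` with gaps `R / 2 ^ (k + 2)`. The fourth power of the
  -- cutoff costs `256 · 16ᵏ`, and `r k ≥ R / 2` costs `4`, which gives the `1024`.
  set r : ℕ → ℝ := fun k => R * (1 / 2 + (1 / 2) ^ (k + 1)) with hr
  set a : ℕ → ℝ := fun k => volume.real (G ∩ Metric.ball x (r k)) / R ^ 2 with ha
  have hp : ∀ k : ℕ, (0:ℝ) < (1 / 2) ^ k := fun k => by positivity
  have hp1 : ∀ k : ℕ, ((1:ℝ) / 2) ^ k ≤ 1 := fun k => pow_le_one₀ (by norm_num) (by norm_num)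
  have hr0 : ∀ k, 0 < r k := fun k => by have := hp (k+1); positivity
  have hrR : ∀ k, r k ≤ R := fun k => by
    have := hp1 k
    simp only [hr, pow_succ]
    nlinarith
  have hr2 : ∀ k, R / 2 ≤ r k := fun k => by
    have := hp (k + 1)
    simp only [hr]
    nlinarith
  have hlim : Tendsto a atTop (𝓝 0) := by
    refine tendsto_zero_of_sq_iteration (L := 1024 * K) (by positivity) (fun k => by positivity) ?_ ?_
    · intro k
      have hrk := hr0 k
      have hd : r (k + 1) = r k - R * (1 / 2) ^ (k + 2) := by simp only [hr]; ring
      have hs := hstep G τ x (r k) (r (k + 1)) hG hτ hv (hr0 k) (hr0 _).le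
        (by rw [hd]; have := hp (k+2); nlinarith) (hle _ (hr0 k) (hrR k))
      set m := volume.real (G ∩ Metric.ball x (r k)) with hm
      set m' := volume.real (G ∩ Metric.ball x (r (k + 1))) with hm'
      have hm0 : 0 ≤ m := measureReal_nonneg
      have hm0' : 0 ≤ m' := measureReal_nonneg
      have hδ : (1 / 2 : ℝ) ^ (k + 2) ≤ 1 - r (k + 1) ^ 2 / r k ^ 2 := by
        rw [le_sub_iff_add_le, ← le_sub_iff_add_le', div_le_iff₀ (by positivity)]
        have h1 : r (k + 1) ≤ r k * (1 - (1 / 2) ^ (k + 2)) := by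
          rw [hd]; have := hp (k+2); nlinarith [hrR k]
        have h2 : 0 ≤ 1 - (1 / 2 : ℝ) ^ (k + 2) := by linarith [hp1 (k + 2)]
        calc r (k + 1) ^ 2 ≤ (r k * (1 - (1 / 2) ^ (k + 2))) ^ 2 := by
              gcongr
          _ = (1 - (1 / 2) ^ (k + 2)) * ((1 - (1 / 2) ^ (k + 2)) * r k ^ 2) := by ring
          _ ≤ 1 * ((1 - (1 / 2) ^ (k + 2)) * r k ^ 2) := by
              gcongr; linarith [hp (k + 2)]
          _ = _ := by ring
      have h3 : ((1 / 2 : ℝ) ^ (k + 2)) ^ 4 * m' ≤ K * (m / (R / 2)) ^ 2 := by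
        refine le_trans ?_ (hs.trans ?_)
        · gcongr
        · gcongr; exact hr2 k
      have h4 : ((1 / 2 : ℝ) ^ (k + 2)) ^ 4 = 1 / (256 * 16 ^ k) := by
        rw [← pow_mul, add_mul, pow_add, mul_comm k, pow_mul, one_div_pow, one_div_pow]
        norm_num
      rw [h4] at h3
      have h16 : (0:ℝ) < 16 ^ k := by positivity
      simp only [ha]
      rw [div_le_iff₀ (by positivity)]
      rw [one_div, inv_mul_le_iff₀ (by positivity)] at h3
      refine h3.trans (le_of_eq ?_)
      field_simp
      ring
    · have : r 0 = R := by simp only [hr]; ring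
      simp only [ha, this]
      rw [div_le_iff₀ (by positivity)]
      exact hlt.le
  have hzero : volume.real (G ∩ Metric.ball x (R / 2)) ≤ 0 := by
    have h1 : volume.real (G ∩ Metric.ball x (R / 2)) / R ^ 2 ≤ 0 := by
      refine ge_of_tendsto' hlim fun k => ?_
      simp only [ha]
      gcongr
      · exact volume_inter_ball_ne_top G x (r k)
      · exact hr2 k
    rw [div_le_iff₀ (by positivity)] at h1
    linarith
  -- With no volume of `G` in `B_{R/2}`, the hypothesis makes `τ` vanish on `B_{R/4}`, against its
  -- positivity.
  have h5 := hle (R / 2) (by positivity) (by linarith)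
  have h6 := mul_measure_le_integral_quadBump τ x (r := R / 2) (s := R / 4) (by positivity)
    (by positivity) (by linarith)
  have h7 : (R / 4) ^ 2 / (R / 2) ^ 2 = 1 / 4 := by field_simp; norm_num
  rw [h7] at h6
  have h8 := hpos (R / 4) (by positivity)
  have h9 : 8 / (R / 2) * volume.real (G ∩ Metric.ball x (R / 2)) ≤ 0 :=
    mul_nonpos_of_nonneg_of_nonpos (by positivity) hzero
  nlinarith

/-! ### Orthonormal coordinates adapted to the normal -/

/-- The affine parametrization of the plane with origin `x` and axes `e`, `ν`. -/
def frame (x e ν : Plane) (p : ℝ × ℝ) : Plane := x + p.1 • e + p.2 • ν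

section Frame

variable {x e ν : Plane}

lemma continuous_frame : Continuous (frame x e ν) := by
  unfold frame; fun_prop

lemma inner_frame_fst (h : Orthonormal ℝ ![e, ν]) (p : ℝ × ℝ) :
    inner ℝ e (frame x e ν p - x) = p.1 := by
  have h1 : ‖e‖ = 1 := by simpa using h.1 0
  have h2 : inner ℝ e ν = (0:ℝ) := h.2 (i := 0) (j := 1) (by simp)
  simp [frame, add_assoc, inner_add_right, inner_smul_right, h1, h2]

lemma inner_frame_snd (h : Orthonormal ℝ ![e, ν]) (p : ℝ × ℝ) :
    inner ℝ ν (frame x e ν p - x) = p.2 := by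
  have h1 : ‖ν‖ = 1 := by simpa using h.1 1
  have h2 : inner ℝ ν e = (0:ℝ) := h.2 (i := 1) (j := 0) (by simp)
  simp [frame, add_assoc, inner_add_right, inner_smul_right, h1, h2]

lemma frame_sub_frame (p q : ℝ × ℝ) :
    frame x e ν p - frame x e ν q = (p.1 - q.1) • e + (p.2 - q.2) • ν := by
  simp only [frame, sub_smul]; abel

lemma norm_smul_add_smul_sq (h : Orthonormal ℝ ![e, ν]) (a b : ℝ) :
    ‖a • e + b • ν‖ ^ 2 = a ^ 2 + b ^ 2 := by
  have h1 : ‖e‖ = 1 := by simpa using h.1 0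
  have h3 : ‖ν‖ = 1 := by simpa using h.1 1
  have h2 : inner ℝ e ν = (0:ℝ) := h.2 (i := 0) (j := 1) (by simp)
  rw [norm_add_sq_real, norm_smul, norm_smul, inner_smul_left, inner_smul_right, h1, h2, h3]
  simp

lemma dist_frame_sq (h : Orthonormal ℝ ![e, ν]) (p q : ℝ × ℝ) :
    dist (frame x e ν p) (frame x e ν q) ^ 2 = (p.1 - q.1) ^ 2 + (p.2 - q.2) ^ 2 := by
  rw [dist_eq_norm, frame_sub_frame, norm_smul_add_smul_sq h]

/-- An orthonormal pair as an orthonormal basis. -/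
def pairBasis (h : Orthonormal ℝ ![e, ν]) : OrthonormalBasis (Fin 2) ℝ Plane :=
  (basisOfOrthonormalOfCardEqFinrank h (by simp)).toOrthonormalBasis (by simpa using h)

lemma coe_pairBasis (h : Orthonormal ℝ ![e, ν]) : ⇑(pairBasis h) = ![e, ν] := by
  simp [pairBasis]

/-- Each factor is a translation, a linear isometry or an identification of coordinates, so
preservation of volume can be read off. -/
lemma frame_eq (h : Orthonormal ℝ ![e, ν]) : frame x e ν =
    (fun z => x + z) ∘ (pairBasis h).repr.symm ∘ (MeasurableEquiv.toLp 2 (Fin 2 → ℝ)) ∘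
      MeasurableEquiv.finTwoArrow.symm := by
  ext1 p
  simp only [Function.comp, MeasurableEquiv.finTwoArrow, ← OrthonormalBasis.sum_repr_symm]
  simp [frame, coe_pairBasis, Fin.sum_univ_two, add_assoc]

lemma measurePreserving_frame (h : Orthonormal ℝ ![e, ν]) : MeasurePreserving (frame x e ν) := by
  rw [frame_eq h]
  refine (measurePreserving_add_left volume x).comp ?_
  refine (pairBasis h).repr.symm.measurePreserving.comp ?_
  refine (PiLp.volume_preserving_toLp (Fin 2)).comp ?_
  exact (volume_preserving_finTwoArrow ℝ).symm

lemma frame_inner (h : Orthonormal ℝ ![e, ν]) (z : Plane) :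
    frame x e ν (inner ℝ e (z - x), inner ℝ ν (z - x)) = z := by
  have := (pairBasis h).sum_repr' (z - x)
  simp only [coe_pairBasis, Fin.sum_univ_two] at this
  simp at this
  simp [frame, add_assoc, this]

lemma measurableEmbedding_frame (h : Orthonormal ℝ ![e, ν]) :
    MeasurableEmbedding (frame x e ν) := by
  refine MeasurableEmbedding.of_measurable_inverse (g := fun z => (inner ℝ e (z - x), inner ℝ ν (z - x)))
    continuous_frame.measurable ?_ ?_ ?_
  · have : Set.range (frame x e ν) = Set.univ :=
      Set.range_eq_univ.2 fun z => ⟨_, frame_inner h z⟩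
    rw [this]; exact MeasurableSet.univ
  · have : Continuous fun z : Plane => ((inner ℝ e (z - x) : ℝ), (inner ℝ ν (z - x) : ℝ)) := by
      fun_prop
    exact this.measurable
  · intro p
    simp [inner_frame_fst h, inner_frame_snd h]

end Frame

/-! ### Path estimates on rectangles -/

/-- Only the positive part of `g'` pays for a rise of `g`. This is why a one-sided flux bound
suffices along a segment of known orientation. -/
lemma ofReal_sub_le_lintegral {g g' : ℝ → ℝ} (hg : ∀ t, HasDerivAt g (g' t) t) (hc : Continuous g')
    {s t a b : ℝ} (hst : s ≤ t) (has : a ≤ s) (htb : t ≤ b) :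
    ENNReal.ofReal (g t - g s) ≤ ∫⁻ u in Set.Icc a b, ENNReal.ofReal (g' u) := by
  rw [← intervalIntegral.integral_eq_sub_of_hasDerivAt (fun u _ => hg u)
    (hc.intervalIntegrable s t), intervalIntegral.integral_of_le hst]
  calc ENNReal.ofReal (∫ u in Set.Ioc s t, g' u) ≤ ENNReal.ofReal (∫ u in Set.Ioc s t, max (g' u) 0) := by
        apply ENNReal.ofReal_le_ofReal
        refine integral_mono ?_ ?_ fun u => le_max_left _ _
        · exact hc.integrableOn_Ioc
        · exact (hc.max continuous_const).integrableOn_Ioc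
    _ = ∫⁻ u in Set.Ioc s t, ENNReal.ofReal (g' u) := by
        have hcm : Continuous fun u => max (g' u) 0 := hc.max continuous_const
        rw [ofReal_integral_eq_lintegral_ofReal hcm.integrableOn_Ioc
          (Eventually.of_forall fun u => le_max_right _ _)]
        refine lintegral_congr fun u => ?_
        rw [ENNReal.ofReal_max]; simp
    _ ≤ _ := lintegral_mono_set (Set.Ioc_subset_Icc_self.trans (Set.Icc_subset_Icc has htb))

/-- Without knowing the order of `s` and `t`, both signs of the derivative have to be paid for. -/
lemma ofReal_sub_le_lintegral_add {g g' : ℝ → ℝ} (hg : ∀ t, HasDerivAt g (g' t) t)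
    (hc : Continuous g') {s t a b : ℝ} (hs : s ∈ Set.Icc a b) (ht : t ∈ Set.Icc a b) :
    ENNReal.ofReal (g t - g s) ≤
      ∫⁻ u in Set.Icc a b, (ENNReal.ofReal (g' u) + ENNReal.ofReal (-g' u)) := by
  rcases le_total s t with h | h
  · refine (ofReal_sub_le_lintegral hg hc h hs.1 ht.2).trans ?_
    exact lintegral_mono fun u => le_self_add
  · have := ofReal_sub_le_lintegral (g := fun u => - g u) (fun u => (hg u).neg) hc.neg h ht.1 hs.2
    rw [neg_sub_neg] at this
    exact this.trans (lintegral_mono fun u => le_add_self)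

lemma hasDerivAt_comp_frame_fst {f : Plane → ℝ} (hf : ContDiff ℝ 1 f) (x e ν : Plane) (t y : ℝ) :
    HasDerivAt (fun t => f (frame x e ν (t, y))) (fderiv ℝ f (frame x e ν (t, y)) e) t := by
  have h1 : HasDerivAt (fun t : ℝ => frame x e ν (t, y)) e t := by
    have := (((hasDerivAt_id t).smul_const e).const_add x).add_const (y • ν)
    simpa [frame] using this
  exact (hf.differentiable (by simp) _).hasFDerivAt.comp_hasDerivAt t h1

lemma hasDerivAt_comp_frame_snd {f : Plane → ℝ} (hf : ContDiff ℝ 1 f) (x e ν : Plane) (t y : ℝ) :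
    HasDerivAt (fun y => f (frame x e ν (t, y))) (fderiv ℝ f (frame x e ν (t, y)) ν) y := by
  have h1 : HasDerivAt (fun y : ℝ => frame x e ν (t, y)) ν y := by
    have := ((hasDerivAt_id y).smul_const ν).const_add (x + t • e)
    simpa [frame] using this
  exact (hf.differentiable (by simp) _).hasFDerivAt.comp_hasDerivAt y h1

lemma continuous_fderiv_frame {f : Plane → ℝ} (hf : ContDiff ℝ 1 f) (x e ν w : Plane) :
    Continuous fun p => fderiv ℝ f (frame x e ν p) w :=
  ((hf.continuous_fderiv (by simp)).comp continuous_frame).clm_apply continuous_const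

lemma lintegral_prod_fst_add_snd {α β : Type*} [MeasurableSpace α] [MeasurableSpace β]
    {μ : Measure α} {ν : Measure β} [SFinite μ] [SFinite ν] {A : α → ℝ≥0∞} {B : β → ℝ≥0∞}
    (hA : Measurable A) (hB : Measurable B) :
    ∫⁻ z, (A z.1 + B z.2) ∂(μ.prod ν) =
      (∫⁻ p, A p ∂μ) * ν Set.univ + (∫⁻ q, B q ∂ν) * μ Set.univ := by
  rw [lintegral_add_left (f := fun z : α × β => A z.1) (hA.comp measurable_fst),
    lintegral_prod (fun z : α × β => A z.1) (hA.comp measurable_fst).aemeasurable,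
    lintegral_prod_symm' (fun z : α × β => B z.2) (hB.comp measurable_snd)]
  simp only [lintegral_const]
  rw [lintegral_mul_const _ hA, lintegral_mul_const _ hB]

/-- Integrated two-segment path estimate between two subsets of a rectangle. -/
lemma lintegral_two_segment_le {F : ℝ × ℝ → ℝ} {H V : ℝ × ℝ → ℝ≥0∞} (hH : Measurable H)
    (hV : Measurable V) {I J J₁ J₂ : Set ℝ} {P N : Set (ℝ × ℝ)} {a b : ℝ≥0∞}
    (hP : P ⊆ I ×ˢ J₁) (hN : N ⊆ I ×ˢ J₂) (hPm : MeasurableSet P) (hNm : MeasurableSet N)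
    (hI : volume I = a) (hJ₁ : volume J₁ = b) (hJ₂ : volume J₂ = b)
    (hh : ∀ p ∈ P, ∀ q ∈ N, ENNReal.ofReal (F p - F (q.1, p.2)) ≤ ∫⁻ t in I, H (t, p.2))
    (hv : ∀ p ∈ P, ∀ q ∈ N, ENNReal.ofReal (F (q.1, p.2) - F q) ≤ ∫⁻ t in J, V (q.1, t)) :
    ∫⁻ z, ENNReal.ofReal (F z.1 - F z.2) ∂((volume.restrict P).prod (volume.restrict N)) ≤
      a * b * (a * ∫⁻ p in I ×ˢ J₁, H p) + a * b * (b * ∫⁻ p in I ×ˢ J, V p) := by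
  have mh : Measurable fun p : ℝ × ℝ => ∫⁻ t in I, H (t, p.2) :=
    (hH.lintegral_prod_left' (μ := volume.restrict I)).comp measurable_snd
  have mv : Measurable fun q : ℝ × ℝ => ∫⁻ t in J, V (q.1, t) :=
    (hV.lintegral_prod_right' (ν := volume.restrict J)).comp measurable_fst
  have hNv : volume N ≤ a * b := by
    refine (measure_mono hN).trans (le_of_eq ?_)
    rw [Measure.volume_eq_prod, Measure.prod_prod, hI, hJ₂]
  have hPv : volume P ≤ a * b := by
    refine (measure_mono hP).trans (le_of_eq ?_)
    rw [Measure.volume_eq_prod, Measure.prod_prod, hI, hJ₁]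
  have i1 : ∫⁻ p in P, ∫⁻ t in I, H (t, p.2) ≤ a * ∫⁻ p in I ×ˢ J₁, H p := by
    calc _ ≤ ∫⁻ p in I ×ˢ J₁, ∫⁻ t in I, H (t, p.2) := lintegral_mono_set hP
      _ = _ := by
        rw [Measure.volume_eq_prod, ← Measure.prod_restrict, lintegral_prod _ mh.aemeasurable,
          lintegral_prod_symm' _ hH]
        simp [hI, mul_comm]
  have i2 : ∫⁻ q in N, ∫⁻ t in J, V (q.1, t) ≤ b * ∫⁻ p in I ×ˢ J, V p := by
    calc _ ≤ ∫⁻ q in I ×ˢ J₂, ∫⁻ t in J, V (q.1, t) := lintegral_mono_set hN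
      _ = _ := by
        rw [Measure.volume_eq_prod, ← Measure.prod_restrict, ← Measure.prod_restrict,
          lintegral_prod_symm' _ mv, lintegral_prod _ hV.aemeasurable]
        simp [hJ₂, mul_comm]
  -- Go through the corner `(q.1, p.2)`. The horizontal cost depends only on the height of `p` and
  -- the vertical cost only on the abscissa of `q`, so the two integrate separately.
  calc _ ≤ ∫⁻ z, ((∫⁻ t in I, H (t, z.1.2)) + ∫⁻ t in J, V (z.2.1, t))
        ∂((volume.restrict P).prod (volume.restrict N)) := by
        rw [Measure.prod_restrict]
        refine setLIntegral_mono' (hPm.prod hNm) fun z hz => ?_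
        have e1 := hh z.1 hz.1 z.2 hz.2
        have e2 := hv z.1 hz.1 z.2 hz.2
        calc _ = ENNReal.ofReal ((F z.1 - F (z.2.1, z.1.2)) + (F (z.2.1, z.1.2) - F z.2)) := by
              congr 1; ring
          _ ≤ _ := ENNReal.ofReal_add_le.trans (add_le_add e1 e2)
    _ = (∫⁻ p in P, ∫⁻ t in I, H (t, p.2)) * volume N +
        (∫⁻ q in N, ∫⁻ t in J, V (q.1, t)) * volume P := by
        rw [lintegral_prod_fst_add_snd mh mv]
        simp only [Measure.restrict_apply MeasurableSet.univ, Set.univ_inter]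
    _ ≤ (a * ∫⁻ p in I ×ˢ J₁, H p) * (a * b) + (b * ∫⁻ p in I ×ˢ J, V p) * (a * b) := by
        gcongr
    _ = _ := by ring


/-- Mollified derivatives integrated over a coordinate rectangle. -/
lemma lintegral_rect_fderiv_mollify_le {x e ν : Plane} (h : Orthonormal ℝ ![e, ν])
    (k : ContDiffBump (0 : Plane)) {G : Set Plane} (hG : MeasurableSet G) {w : Plane}
    {σ : Measure Plane} [IsFiniteMeasure σ] (hσ : FluxBound G (-w) σ) {Q : Set (ℝ × ℝ)}
    (hQ : MeasurableSet Q) {U : Set Plane} (hU : MeasurableSet U)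
    (hQU : ∀ p ∈ Q, Metric.ball (frame x e ν p) k.rOut ⊆ U) :
    ∫⁻ p in Q, ENNReal.ofReal (fderiv ℝ (mollify k G fun _ => 1) (frame x e ν p) w) ≤ σ U := by
  have h1 := (measurePreserving_frame (x := x) h).setLIntegral_comp_emb (measurableEmbedding_frame h)
    (fun z => ENNReal.ofReal (fderiv ℝ (mollify k G fun _ => 1) z w)) Q
  rw [h1]
  refine setLIntegral_fderiv_mollify_one_le k hG hσ hU ?_
    ((measurableEmbedding_frame h).measurableSet_image.2 hQ)
  rintro _ ⟨p, hp, rfl⟩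
  exact hQU p hp

/-- Passing to the limit in the two-segment estimate. -/
lemma volume_mul_volume_le_of_mollify {x e ν : Plane} (h : Orthonormal ℝ ![e, ν])
    {G : Set Plane} (hG : MeasurableSet G) {P N : Set (ℝ × ℝ)} (hPm : MeasurableSet P)
    (hNm : MeasurableSet N) (hP : ∀ p ∈ P, frame x e ν p ∈ G) (hN : ∀ p ∈ N, frame x e ν p ∉ G)
    {M : ℝ≥0∞}
    (hM : ∀ᶠ n in atTop, ∫⁻ z, ENNReal.ofReal
      (mollify (kernelSeq n) G (fun _ => 1) (frame x e ν z.1) -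
        mollify (kernelSeq n) G (fun _ => 1) (frame x e ν z.2))
      ∂((volume.restrict P).prod (volume.restrict N)) ≤ M) :
    volume P * volume N ≤ M := by
  set F : ℕ → ℝ × ℝ → ℝ := fun n p => mollify (kernelSeq n) G (fun _ => 1) (frame x e ν p) with hF
  have hFc : ∀ n, Continuous (F n) := fun n =>
    (contDiff_mollify (kernelSeq n) hG continuous_const).continuous.comp continuous_frame
  have hlim : ∀ᵐ p : ℝ × ℝ, Tendsto (fun n => F n p) atTop
      (𝓝 (G.indicator (fun _ => (1:ℝ)) (frame x e ν p))) :=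
    (measurePreserving_frame h).quasiMeasurePreserving.ae (ae_tendsto_mollify hG continuous_const)
  have l1 : ∀ᵐ p ∂(volume.restrict P), Tendsto (fun n => F n p) atTop (𝓝 1) := by
    rw [ae_restrict_iff' hPm]
    filter_upwards [hlim] with p hp hpP
    simpa [hP p hpP] using hp
  have l0 : ∀ᵐ p ∂(volume.restrict N), Tendsto (fun n => F n p) atTop (𝓝 0) := by
    rw [ae_restrict_iff' hNm]
    filter_upwards [hlim] with p hp hpN
    simpa [hN p hpN] using hp
  -- On `P × N` the difference tends to `1 − 0`, so Fatou bounds the product of the volumes by `M`.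
  have l2 : ∀ᵐ z ∂((volume.restrict P).prod (volume.restrict N)),
      Tendsto (fun n => ENNReal.ofReal (F n z.1 - F n z.2)) atTop (𝓝 1) := by
    have a1 := Measure.quasiMeasurePreserving_fst (μ := volume.restrict P)
      (ν := volume.restrict N) |>.ae l1
    have a0 := Measure.quasiMeasurePreserving_snd (μ := volume.restrict P)
      (ν := volume.restrict N) |>.ae l0
    filter_upwards [a1, a0] with z h1 h0
    have := (ENNReal.continuous_ofReal.tendsto _).comp (h1.sub h0)
    simpa using! this
  calc volume P * volume N = ∫⁻ z, 1 ∂((volume.restrict P).prod (volume.restrict N)) := by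
        rw [lintegral_one, ← Set.univ_prod_univ, Measure.prod_prod]; simp
    _ ≤ ∫⁻ z, liminf (fun n => ENNReal.ofReal (F n z.1 - F n z.2)) atTop
        ∂((volume.restrict P).prod (volume.restrict N)) := by
        refine lintegral_mono_ae ?_
        filter_upwards [l2] with z hz
        exact hz.liminf_eq.ge
    _ ≤ liminf (fun n => ∫⁻ z, ENNReal.ofReal (F n z.1 - F n z.2)
        ∂((volume.restrict P).prod (volume.restrict N))) atTop := by
        refine lintegral_liminf_le fun n => ?_
        have : Continuous fun z : (ℝ × ℝ) × (ℝ × ℝ) => F n z.1 - F n z.2 :=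
          ((hFc n).comp continuous_fst).sub ((hFc n).comp continuous_snd)
        exact this.measurable.ennreal_ofReal
    _ ≤ M := by
        refine (liminf_le_liminf hM).trans ?_
        simp

lemma lintegral_rect_abs_fderiv_mollify_le {x e ν : Plane} (h : Orthonormal ℝ ![e, ν])
    (k : ContDiffBump (0 : Plane)) {G : Set Plane} (hG : MeasurableSet G) {w : Plane}
    {σ σ' : Measure Plane} [IsFiniteMeasure σ] [IsFiniteMeasure σ'] (hσ : FluxBound G (-w) σ)
    (hσ' : FluxBound G w σ') {Q : Set (ℝ × ℝ)}
    (hQ : MeasurableSet Q) {U : Set Plane} (hU : MeasurableSet U)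
    (hQU : ∀ p ∈ Q, Metric.ball (frame x e ν p) k.rOut ⊆ U) :
    ∫⁻ p in Q, (ENNReal.ofReal (fderiv ℝ (mollify k G fun _ => 1) (frame x e ν p) w) +
      ENNReal.ofReal (-fderiv ℝ (mollify k G fun _ => 1) (frame x e ν p) w)) ≤ σ U + σ' U := by
  rw [lintegral_add_left]
  · refine add_le_add (lintegral_rect_fderiv_mollify_le h k hG hσ hQ hU hQU) ?_
    have := lintegral_rect_fderiv_mollify_le h k hG (w := -w) (by simpa using hσ') hQ hU hQU
    simpa using this
  · exact (continuous_fderiv_frame (contDiff_mollify k hG continuous_const) x e ν w).measurable.ennreal_ofReal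

section Rectangle

variable {x e ν : Plane} {G : Set Plane} {σ₁ σ₂ σ₃ : Measure Plane} {s t u₁ u₂ j₀ j₁ a b δ : ℝ}
  {P N : Set (ℝ × ℝ)} {U : Set Plane}

/-- Rectangle estimate: `P ⊆ G` lies above `N ⊆ Gᶜ`. -/
lemma volume_mul_volume_le_of_above [IsFiniteMeasure σ₁] [IsFiniteMeasure σ₂]
    (h : Orthonormal ℝ ![e, ν])
    (hG : MeasurableSet G) (h₁ : FluxBound G e σ₁) (h₁' : FluxBound G (-e) σ₁)
    (h₂ : FluxBound G (-ν) σ₂) (hPm : MeasurableSet P) (hNm : MeasurableSet N)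
    (hPG : ∀ p ∈ P, frame x e ν p ∈ G) (hNG : ∀ p ∈ N, frame x e ν p ∉ G)
    (hP : P ⊆ Set.Icc s (s + a) ×ˢ Set.Icc u₁ (u₁ + b))
    (hN : N ⊆ Set.Icc s (s + a) ×ˢ Set.Icc u₂ (u₂ + b))
    (hPN : ∀ p ∈ P, ∀ q ∈ N, q.2 ≤ p.2) (hj₁ : Set.Icc u₁ (u₁ + b) ⊆ Set.Icc j₀ j₁)
    (hj₂ : Set.Icc u₂ (u₂ + b) ⊆ Set.Icc j₀ j₁) (hU : MeasurableSet U) (hδ : 0 < δ)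
    (hQU : ∀ p ∈ Set.Icc s (s + a) ×ˢ Set.Icc j₀ j₁, Metric.ball (frame x e ν p) δ ⊆ U) :
    volume P * volume N ≤ ENNReal.ofReal a * ENNReal.ofReal b * (ENNReal.ofReal a * (2 * σ₁ U)) +
      ENNReal.ofReal a * ENNReal.ofReal b * (ENNReal.ofReal b * σ₂ U) := by
  refine volume_mul_volume_le_of_mollify (x := x) h hG hPm hNm hPG hNG ?_
  filter_upwards [tendsto_kernelSeq_rOut.eventually_lt_const hδ] with n hn
  have hQ : ∀ p ∈ Set.Icc s (s + a) ×ˢ Set.Icc j₀ j₁,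
      Metric.ball (frame x e ν p) (kernelSeq n).rOut ⊆ U := fun p hp =>
    (Metric.ball_subset_ball hn.le).trans (hQU p hp)
  have hf := contDiff_mollify (kernelSeq n) hG (φ := fun _ => 1) continuous_const
  have me := (continuous_fderiv_frame hf x e ν e).measurable
  have mν := (continuous_fderiv_frame hf x e ν ν).measurable
  refine (lintegral_two_segment_le (F := fun p => mollify (kernelSeq n) G (fun _ => 1) (frame x e ν p))
    (me.ennreal_ofReal.add me.neg.ennreal_ofReal) mν.ennreal_ofReal
    (J := Set.Icc j₀ j₁) hP hN hPm hNm (a := ENNReal.ofReal a) (b := ENNReal.ofReal b)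
    (by simp) (by simp) (by simp) ?_ ?_).trans ?_
  · intro p hp q hq
    exact ofReal_sub_le_lintegral_add (fun t => hasDerivAt_comp_frame_fst hf x e ν t p.2)
      ((continuous_fderiv_frame hf x e ν e).comp (by fun_prop)) (hN hq).1 (hP hp).1
  · intro p hp q hq
    -- As `P` lies above `N`, the vertical segment is always climbed from `Gᶜ` towards `G`, so only
    -- the one-sided bound by `σ₂` is used.
    exact ofReal_sub_le_lintegral (fun t => hasDerivAt_comp_frame_snd hf x e ν q.1 t)
      ((continuous_fderiv_frame hf x e ν ν).comp (by fun_prop)) (hPN p hp q hq)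
      (hj₂ (hN hq).2).1 (hj₁ (hP hp).2).2
  · gcongr
    · rw [two_mul]
      exact lintegral_rect_abs_fderiv_mollify_le h _ hG h₁' h₁ (measurableSet_Icc.prod measurableSet_Icc)
        hU fun p hp => hQ p ⟨hp.1, hj₁ hp.2⟩
    · exact lintegral_rect_fderiv_mollify_le h _ hG h₂ (measurableSet_Icc.prod measurableSet_Icc) hU hQ

/-- Rectangle estimate without assumptions on the relative position of `P ⊆ G` and `N ⊆ Gᶜ`. -/
lemma volume_mul_volume_le [IsFiniteMeasure σ₁] (h : Orthonormal ℝ ![e, ν])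
    (hG : MeasurableSet G) (h₁ : VariationBound G σ₁)
    (hPm : MeasurableSet P) (hNm : MeasurableSet N)
    (hPG : ∀ p ∈ P, frame x e ν p ∈ G) (hNG : ∀ p ∈ N, frame x e ν p ∉ G)
    (hP : P ⊆ Set.Icc s (s + a) ×ˢ Set.Icc u₁ (u₁ + a))
    (hN : N ⊆ Set.Icc s (s + a) ×ˢ Set.Icc u₁ (u₁ + a)) (hU : MeasurableSet U) (hδ : 0 < δ)
    (hQU : ∀ p ∈ Set.Icc s (s + a) ×ˢ Set.Icc u₁ (u₁ + a), Metric.ball (frame x e ν p) δ ⊆ U) :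
    volume P * volume N ≤ 4 * ENNReal.ofReal a ^ 3 * σ₁ U := by
  refine volume_mul_volume_le_of_mollify (x := x) h hG hPm hNm hPG hNG ?_
  filter_upwards [tendsto_kernelSeq_rOut.eventually_lt_const hδ] with n hn
  have hQ : ∀ p ∈ Set.Icc s (s + a) ×ˢ Set.Icc u₁ (u₁ + a),
      Metric.ball (frame x e ν p) (kernelSeq n).rOut ⊆ U := fun p hp =>
    (Metric.ball_subset_ball hn.le).trans (hQU p hp)
  have hf := contDiff_mollify (kernelSeq n) hG (φ := fun _ => 1) continuous_const
  have me := (continuous_fderiv_frame hf x e ν e).measurable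
  have mν := (continuous_fderiv_frame hf x e ν ν).measurable
  have ne : ‖e‖ = 1 := by simpa using h.1 0
  have nν : ‖ν‖ = 1 := by simpa using h.1 1
  have hm := (measurableSet_Icc (a := s) (b := s + a)).prod (measurableSet_Icc (a := u₁) (b := u₁ + a))
  refine (lintegral_two_segment_le (F := fun p => mollify (kernelSeq n) G (fun _ => 1) (frame x e ν p))
    (me.ennreal_ofReal.add me.neg.ennreal_ofReal) (mν.ennreal_ofReal.add mν.neg.ennreal_ofReal)
    (J := Set.Icc u₁ (u₁ + a)) hP hN hPm hNm (a := ENNReal.ofReal a) (b := ENNReal.ofReal a)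
    (by simp) (by simp) (by simp) ?_ ?_).trans ?_
  · intro p hp q hq
    exact ofReal_sub_le_lintegral_add (fun t => hasDerivAt_comp_frame_fst hf x e ν t p.2)
      ((continuous_fderiv_frame hf x e ν e).comp (by fun_prop)) (hN hq).1 (hP hp).1
  · intro p hp q hq
    exact ofReal_sub_le_lintegral_add (fun t => hasDerivAt_comp_frame_snd hf x e ν q.1 t)
      ((continuous_fderiv_frame hf x e ν ν).comp (by fun_prop)) (hN hq).2 (hP hp).2
  · calc _ ≤ ENNReal.ofReal a * ENNReal.ofReal a * (ENNReal.ofReal a * (σ₁ U + σ₁ U)) +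
          ENNReal.ofReal a * ENNReal.ofReal a * (ENNReal.ofReal a * (σ₁ U + σ₁ U)) := by
          gcongr
          · exact lintegral_rect_abs_fderiv_mollify_le h _ hG (h₁ _ (by simpa)) (h₁ _ ne) hm hU hQ
          · exact lintegral_rect_abs_fderiv_mollify_le h _ hG (h₁ _ (by simpa)) (h₁ _ nν) hm hU hQ
      _ = _ := by ring

end Rectangle

/-! ### Density of the variation and Vitali covering -/

lemma exists_orthonormal_pair {ν : Plane} (hν : ‖ν‖ = 1) : ∃ e : Plane, Orthonormal ℝ ![e, ν] := by
  refine ⟨!₂[-ν 1, ν 0], ?_⟩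
  have h1 : ν 0 ^ 2 + ν 1 ^ 2 = 1 := by
    have := EuclideanSpace.real_norm_sq_eq ν
    rw [hν, Fin.sum_univ_two] at this; linarith
  have h2 : ‖(!₂[-ν 1, ν 0] : Plane)‖ = 1 := by
    rw [EuclideanSpace.norm_eq, Fin.sum_univ_two]
    simp [add_comm, h1]
  constructor
  · intro i; fin_cases i <;> simp [h2, hν]
  · intro i j hij
    fin_cases i <;> fin_cases j <;> simp at hij ⊢ <;>
      simp [PiLp.inner_apply, Fin.sum_univ_two] <;> ring

/-- Lower density of the variation from lower density of both volumes. -/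
lemma le_measure_ball_of_le_volume {G : Set Plane} {τ : Measure Plane} {x : Plane} {R c : ℝ}
    (hG : MeasurableSet G) [IsFiniteMeasure τ] (hτ : VariationBound G τ) (hR : 0 < R) (hc : 0 < c)
    (h₁ : c * R ^ 2 ≤ volume.real (G ∩ Metric.ball x R))
    (h₂ : c * R ^ 2 ≤ volume.real (Gᶜ ∩ Metric.ball x R)) :
    c ^ 2 / 32 * R ≤ τ.real (Metric.ball x (3 * R)) := by
  obtain ⟨e, he⟩ := exists_orthonormal_pair (ν := EuclideanSpace.single 0 1) (by simp)
  set ν : Plane := EuclideanSpace.single 0 1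
  have hmp := measurePreserving_frame (x := x) he
  have hfx : frame x e ν (0, 0) = x := by simp [frame]
  have hsub : ∀ p : ℝ × ℝ, frame x e ν p ∈ Metric.ball x R →
      p ∈ Set.Icc (-R) (-R + 2 * R) ×ˢ Set.Icc (-R) (-R + 2 * R) := by
    intro p hp
    have h := dist_frame_sq (x := x) he p (0, 0)
    rw [hfx, sub_zero, sub_zero] at h
    rw [Metric.mem_ball] at hp
    have h' : p.1 ^ 2 + p.2 ^ 2 ≤ R ^ 2 := by rw [← h]; gcongr
    refine ⟨⟨?_, ?_⟩, ?_, ?_⟩ <;> nlinarith [sq_nonneg p.1, sq_nonneg p.2]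
  have m₁ : MeasurableSet (G ∩ Metric.ball x R) := hG.inter measurableSet_ball
  have m₂ : MeasurableSet (Gᶜ ∩ Metric.ball x R) := hG.compl.inter measurableSet_ball
  -- A relative isoperimetric inequality in the square of side `2R`: `(c R²)² ≤ 4 (2R)³ τ`, whence
  -- `c² / 32`. The square lies within `2R` of `x`, and the margin `R` for the mollifier leads to
  -- `B_{3R}`.
  have key := volume_mul_volume_le (x := x) (σ₁ := τ) (P := frame x e ν ⁻¹' (G ∩ Metric.ball x R))
    (N := frame x e ν ⁻¹' (Gᶜ ∩ Metric.ball x R)) (s := -R) (a := 2 * R) (u₁ := -R)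
    (U := Metric.ball x (3 * R)) (δ := R) he hG hτ (hmp.measurable m₁) (hmp.measurable m₂)
    (fun p hp => hp.1) (fun p hp => hp.1) (fun p hp => hsub p hp.2) (fun p hp => hsub p hp.2)
    measurableSet_ball hR ?_
  · rw [hmp.measure_preimage m₁.nullMeasurableSet, hmp.measure_preimage m₂.nullMeasurableSet] at key
    have k2 := ENNReal.toReal_mono (by finiteness) key
    simp only [ENNReal.toReal_mul, ENNReal.toReal_pow, ENNReal.toReal_ofReal (show 0 ≤ 2 * R by linarith),
      ENNReal.toReal_ofNat] at k2
    simp only [measureReal_def] at h₁ h₂ ⊢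
    have k3 : (c * R ^ 2) * (c * R ^ 2) ≤ 4 * (2 * R) ^ 3 * (τ (Metric.ball x (3 * R))).toReal :=
      le_trans (by gcongr) k2
    have k4 : R ^ 3 * (c ^ 2 * R) ≤ R ^ 3 * (32 * (τ (Metric.ball x (3 * R))).toReal) := by
      nlinarith [k3]
    have := le_of_mul_le_mul_left k4 (by positivity)
    linarith
  · rintro p ⟨⟨a1, a2⟩, a3, a4⟩
    apply Metric.ball_subset_ball'
    have h := dist_frame_sq (x := x) he p (0, 0)
    rw [hfx, sub_zero, sub_zero] at h
    have : dist (frame x e ν p) x ≤ 2 * R := by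
      refine le_of_pow_le_pow_left₀ two_ne_zero (by positivity) ?_
      rw [h]; nlinarith
    linarith

/-- A measure with positive lower density on `S` controls the one-dimensional Hausdorff measure. -/
lemma hausdorffMeasure_le_of_density {X : Type*} [MetricSpace X] [MeasurableSpace X] [BorelSpace X]
    [SecondCountableTopology X] (τ : Measure X) {S U : Set X} {c : ℝ} (hc : 0 < c)
    (h : ∀ x ∈ S, ∀ ε > (0:ℝ), ∃ ρ, 0 < ρ ∧ ρ < ε ∧ Metric.closedBall x ρ ⊆ U ∧
      ENNReal.ofReal (c * ρ) ≤ τ (Metric.closedBall x ρ)) :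
    Measure.hausdorffMeasure 1 S ≤ ENNReal.ofReal (10 / c) * τ U := by
  have h' : ∀ n : ℕ, ∃ ρ : X → ℝ, ∀ x ∈ S, 0 < ρ x ∧ ρ x < 1 / ((n:ℝ) + 1) ∧
      Metric.closedBall x (ρ x) ⊆ U ∧ ENNReal.ofReal (c * ρ x) ≤ τ (Metric.closedBall x (ρ x)) := by
    intro n
    choose! ρ hρ using fun x hx => h x hx (1 / ((n:ℝ) + 1)) (by positivity)
    exact ⟨ρ, hρ⟩
  choose ρ hρ using h'
  -- Vitali's lemma: the disjoint balls carry the mass and their fivefold enlargements cover `S`.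
  -- The enlarged diameters are at most `10 ρ`, which is the source of `10 / c`.
  have hu : ∀ n : ℕ, ∃ u ⊆ S, u.PairwiseDisjoint (fun x => Metric.closedBall x (ρ n x)) ∧
      ∀ a ∈ S, ∃ b ∈ u, Metric.closedBall a (ρ n a) ⊆ Metric.closedBall b (5 * ρ n b) := fun n =>
    Vitali.exists_disjoint_subfamily_covering_enlargement_closedBall S id (ρ n) (1 / ((n:ℝ) + 1))
      (fun a ha => (hρ n a ha).2.1.le) 5 (by norm_num)
  choose u huS hud huc using hu
  have hcount : ∀ n, (u n).Countable := fun n =>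
    (hud n).countable_of_nonempty_interior fun x hx => by
      refine ⟨x, Metric.ball_subset_interior_closedBall (Metric.mem_ball_self (hρ n x (huS n hx)).1)⟩
  have : ∀ n, Countable (u n) := fun n => (hcount n).to_subtype
  have hdiam : ∀ n (i : u n), Metric.ediam (Metric.closedBall (i : X) (5 * ρ n i)) ≤
      ENNReal.ofReal (10 * ρ n i) := by
    intro n i
    have h0 := (hρ n i (huS n i.2)).1
    refine (Metric.ediam_le_of_forall_dist_le (C := 10 * ρ n i) fun a ha b hb => ?_)
    have := dist_triangle_right a b (i : X)
    rw [Metric.mem_closedBall] at ha hb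
    linarith
  refine (Measure.hausdorffMeasure_le_liminf_tsum (ι := fun n => u n) 1 S (l := atTop)
    (fun n : ℕ => ENNReal.ofReal (10 * (1 / ((n:ℝ) + 1)))) ?_
    (fun n i => Metric.closedBall (i : X) (5 * ρ n i)) ?_ ?_).trans ?_
  · have := (tendsto_one_div_add_atTop_nhds_zero_nat (𝕜 := ℝ)).const_mul 10
    rw [mul_zero] at this
    simpa only [ENNReal.ofReal_zero, Function.comp_def] using
      (ENNReal.continuous_ofReal.tendsto _).comp this
  · refine Eventually.of_forall fun n i => (hdiam n i).trans ?_
    apply ENNReal.ofReal_le_ofReal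
    have := (hρ n i (huS n i.2)).2.1.le
    gcongr
  · refine Eventually.of_forall fun n x hx => ?_
    obtain ⟨b, hb, hsub⟩ := huc n x hx
    exact Set.mem_iUnion.2 ⟨⟨b, hb⟩, hsub (Metric.mem_closedBall_self (hρ n x hx).1.le)⟩
  · have hn : ∀ n : ℕ, ∑' i : u n, Metric.ediam (Metric.closedBall (i : X) (5 * ρ n i)) ^ (1:ℝ) ≤
        ENNReal.ofReal (10 / c) * τ U := by
      intro n
      calc _ ≤ ∑' i : u n, ENNReal.ofReal (10 / c) * τ (Metric.closedBall (i : X) (ρ n i)) := by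
            refine ENNReal.tsum_le_tsum fun i => ?_
            rw [ENNReal.rpow_one]
            refine (hdiam n i).trans ?_
            have h4 := (hρ n i (huS n i.2)).2.2.2
            calc ENNReal.ofReal (10 * ρ n i) = ENNReal.ofReal (10 / c) * ENNReal.ofReal (c * ρ n i) := by
                  rw [← ENNReal.ofReal_mul (by positivity)]; congr 1; field_simp
              _ ≤ _ := by gcongr
        _ = ENNReal.ofReal (10 / c) * τ (⋃ i ∈ u n, Metric.closedBall i (ρ n i)) := by
            rw [ENNReal.tsum_mul_left, measure_biUnion (hcount n) (hud n)
              fun i _ => Metric.isClosed_closedBall.measurableSet]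
        _ ≤ _ := by
            gcongr
            exact Set.iUnion₂_subset fun i hi => (hρ n i (huS n hi)).2.2.1
    refine (liminf_le_liminf (Eventually.of_forall hn)).trans ?_
    simp

/-! ### Reduced boundary points and their density estimates -/

/-- The information carried by a point `x` of the reduced boundary of `G` with total variation `τ`:
the normal `ν` and the excess measure `θ = τ - ⟨ν, μ_G⟩`. -/
structure IsReducedPoint (G : Set Plane) (τ : Measure Plane) (x ν : Plane) (θ : Measure Plane) :
    Prop where
  norm_eq : ‖ν‖ = 1
  finite : IsFiniteMeasure θ
  flux : FluxBound G (-ν) θ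
  integral_eq : ∀ φ : Plane → ℝ, ContDiff ℝ 1 φ → HasCompactSupport φ →
    ∫ y, φ y ∂τ = ∫ y, φ y ∂θ + ∫ y in G, fderiv ℝ φ y ν
  tangential : ∀ e, Orthonormal ℝ ![e, ν] → ∀ η > (0:ℝ),
    FluxBound G e (η.toNNReal • τ + (η⁻¹).toNNReal • θ) ∧
    FluxBound G (-e) (η.toNNReal • τ + (η⁻¹).toNNReal • θ)
  excess : ∀ κ, 0 < κ → κ < 1 → ∃ r₀ > (0:ℝ), ∀ r, 0 < r → r < r₀ →
    0 < τ.real (Metric.ball x r) ∧ θ.real (Metric.ball x r) ≤ κ * τ.real (Metric.ball x r)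

lemma IsGaussGreenMeasure.congr {E G : Set Plane} {μ : VectorMeasure Plane Plane}
    (h : IsGaussGreenMeasure E μ) (hEG : G =ᵐ[volume] E) : IsGaussGreenMeasure G μ := by
  intro φ h1 h2
  rw [← h φ h1 h2, setIntegral_congr_set hEG]

/-- Pythagoras gives `⟨e, v⟩² ≤ 2 t (t − ⟨ν, v⟩)`. The weighted arithmetic–geometric mean inequality
makes the bound linear in `t` and in the excess, so that with `v = μ S` it becomes domination by a
measure. -/
lemma abs_inner_le_of_orthonormal {e ν v : Plane} (h : Orthonormal ℝ ![e, ν]) {t η : ℝ}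
    (hη : 0 < η) (hv : ‖v‖ ≤ t) :
    |inner ℝ e v| ≤ η * t + η⁻¹ * (t - inner ℝ ν v) := by
  have hn : inner ℝ e v ^ 2 + inner ℝ ν v ^ 2 = ‖v‖ ^ 2 := by
    have := frame_inner (x := 0) h v
    rw [← norm_smul_add_smul_sq h]
    simp only [frame, sub_zero, zero_add] at this
    rw [this]
  have ht : 0 ≤ t := (norm_nonneg v).trans hv
  have hle : inner ℝ ν v ≤ t := by
    refine (real_inner_le_norm _ _).trans ?_
    have : ‖ν‖ = 1 := by simpa using h.1 1
    rwa [this, one_mul]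
  have h1 : 0 ≤ t - inner ℝ ν v := by linarith
  have h2 : inner ℝ e v ^ 2 ≤ 2 * t * (t - inner ℝ ν v) := by
    have : ‖v‖ ^ 2 ≤ t ^ 2 := by gcongr
    nlinarith
  refine abs_le_of_sq_le_sq' ?_ (by positivity) |> abs_le.2
  have h3 : η * η⁻¹ = 1 := mul_inv_cancel₀ hη.ne'
  have h4 : (η * t + η⁻¹ * (t - inner ℝ ν v)) ^ 2 = (η * t) ^ 2 + 2 * (η * η⁻¹) * t * (t - inner ℝ ν v)
    + (η⁻¹ * (t - inner ℝ ν v)) ^ 2 := by ring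
  rw [h4, h3]
  nlinarith [sq_nonneg (η * t), sq_nonneg (η⁻¹ * (t - inner ℝ ν v))]

lemma variationBound_of_isGaussGreenMeasure {G : Set Plane} {μ : VectorMeasure Plane Plane}
    [IsFiniteMeasure μ.variation] (hμ : IsGaussGreenMeasure G μ) :
    VariationBound G μ.variation := by
  intro e he
  refine fluxBound_of_le hμ fun S _ => ?_
  refine (real_inner_le_norm _ _).trans ?_
  rw [he, one_mul]
  exact VectorMeasure.norm_measure_le_variation

/-- The witness is `θ = |μ| − ⟨ν, μ⟩`. Pairing the limit with `ν` gives `θ(B_r) / |μ|(B_r) → 1 −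
‖ν‖² = 0`. -/
lemma exists_isReducedPoint {G : Set Plane} {μ : VectorMeasure Plane Plane}
    [IsFiniteMeasure μ.variation] (hμ : IsGaussGreenMeasure G μ) {x ν : Plane} (hν : ‖ν‖ = 1)
    (hlim : Tendsto (fun r : ℝ => (μ.variation.real (Metric.ball x r))⁻¹ • μ (Metric.ball x r))
      (𝓝[>] 0) (𝓝 ν)) :
    ∃ θ, IsReducedPoint G μ.variation x ν θ := by
  have hle : ∀ S, MeasurableSet S → inner ℝ ν (μ S) ≤ μ.variation.real S := fun S _ => by
    refine (real_inner_le_norm _ _).trans ?_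
    rw [hν, one_mul]
    exact VectorMeasure.norm_measure_le_variation
  obtain ⟨θ, hθ, hS⟩ := exists_measure_eq_sub_inner hle
  refine ⟨θ, hν, hθ, ?_, ?_, ?_, ?_⟩
  · refine fluxBound_of_le hμ fun S hSm => ?_
    have h1 := hS S hSm
    have h2 : 0 ≤ μ.variation.real S := measureReal_nonneg
    rw [inner_neg_left]; linarith
  · intro φ h1 h2
    rw [integral_fderiv_apply_eq_inner hμ h1 h2,
      ← inner_integral_add_integral_eq hS h1.continuous h2]
    ring
  · intro e he η hη
    have key : ∀ S, MeasurableSet S → |inner ℝ e (μ S)| ≤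
        (η.toNNReal • μ.variation + (η⁻¹).toNNReal • θ).real S := by
      intro S hSm
      have h1 := abs_inner_le_of_orthonormal he hη
        (VectorMeasure.norm_measure_le_variation (μ := μ) (E := S))
      have h2 := hS S hSm
      have h3 : (η.toNNReal • μ.variation + (η⁻¹).toNNReal • θ).real S =
          η * μ.variation.real S + η⁻¹ * θ.real S := by
        rw [measureReal_add_apply, measureReal_nnreal_smul_apply, measureReal_nnreal_smul_apply,
          Real.coe_toNNReal _ hη.le, Real.coe_toNNReal _ (by positivity)]
      rw [h3]
      have h4 : θ.real S = μ.variation.real S - inner ℝ ν (μ S) := by linarith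
      rwa [h4]
    constructor
    · exact fluxBound_of_le hμ fun S hSm => (le_abs_self _).trans (key S hSm)
    · refine fluxBound_of_le hμ fun S hSm => ?_
      rw [inner_neg_left]
      exact (neg_le_abs _).trans (key S hSm)
  · intro κ h0 h1
    have hl := (tendsto_const_nhds (x := ν)).inner hlim (𝕜 := ℝ)
    rw [real_inner_self_eq_norm_sq, hν, one_pow] at hl
    have hev := hl.eventually_const_lt (show 1 - κ < 1 by linarith)
    rw [eventually_nhdsWithin_iff, Metric.eventually_nhds_iff] at hev
    obtain ⟨r₀, hr₀, hr⟩ := hev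
    refine ⟨r₀, hr₀, fun r hr0 hrr => ?_⟩
    have h2 := hr (y := r) (by rw [Real.dist_eq, sub_zero, abs_of_pos hr0]; exact hrr) hr0
    rw [inner_smul_right] at h2
    have h3 := hS (Metric.ball x r) measurableSet_ball
    -- If the variation vanished, the inverse of zero would make the quotient `0`, below `1 − κ`;
    -- here `κ < 1` matters.
    have hpos : 0 < μ.variation.real (Metric.ball x r) := by
      rcases (measureReal_nonneg (μ := μ.variation) (s := Metric.ball x r)).eq_or_lt with h | h
      · rw [← h] at h2; simp at h2; linarith
      · exact h
    refine ⟨hpos, ?_⟩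
    rw [inv_mul_eq_div, lt_div_iff₀ hpos] at h2
    linarith

section

variable {G : Set Plane} {τ θ : Measure Plane} {x ν : Plane}

lemma IsReducedPoint.measure_ball_pos [IsFiniteMeasure τ] (h : IsReducedPoint G τ x ν θ) {r : ℝ}
    (hr : 0 < r) : 0 < τ.real (Metric.ball x r) := by
  obtain ⟨r₀, hr₀, h1⟩ := h.excess (1 / 2) (by norm_num) (by norm_num)
  have h2 := (h1 (min r (r₀ / 2)) (by positivity) ((min_le_right _ _).trans_lt (by linarith))).1
  exact h2.trans_le (measureReal_mono (Metric.ball_subset_ball (min_le_left _ _)))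

/-- Once the excess is at most half the variation, the variation is controlled by the flux of `ν`,
hence by the volume of `G`; for the complement the normal is reversed. -/
lemma IsReducedPoint.exists_integral_quadBump_le [IsFiniteMeasure τ]
    (h : IsReducedPoint G τ x ν θ) (hG : MeasurableSet G) :
    ∃ r₀ > (0:ℝ), ∀ r, 0 < r → r ≤ r₀ →
      ∫ y, quadBump x r y ∂τ ≤ 8 / r * volume.real (G ∩ Metric.ball x r) ∧
      ∫ y, quadBump x r y ∂τ ≤ 8 / r * volume.real (Gᶜ ∩ Metric.ball x r) := by
  obtain ⟨r₀, hr₀, h1⟩ := h.excess (1 / 2) (by norm_num) (by norm_num)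
  have := h.finite
  refine ⟨r₀ / 2, by positivity, fun r hr hrr => ?_⟩
  have h2 := h.integral_eq _ (contDiff_quadBump x r) (hasCompactSupport_quadBump x hr)
  have h3 : ∀ s, 0 < s → s ≤ r → θ.real (Metric.ball x s) ≤ 1 / 2 * τ.real (Metric.ball x s) :=
    fun s hs hsr => (h1 s hs (by linarith)).2
  refine ⟨integral_quadBump_le_volume hr h.norm_eq.le h2.le h3, ?_⟩
  refine integral_quadBump_le_volume (ν := -ν) hr (by simpa using h.norm_eq.le) ?_ h3
  rw [h2, setIntegral_compl_fderiv hG.nullMeasurableSet (contDiff_quadBump x r)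
    (hasCompactSupport_quadBump x hr)]
  simp [integral_neg]

lemma volume_real_inter_ball_le (G : Set Plane) (x : Plane) {r : ℝ} (hr : 0 ≤ r) :
    volume.real (G ∩ Metric.ball x r) ≤ 4 * r ^ 2 := by
  calc _ ≤ volume.real (Metric.ball x r) := measureReal_mono Set.inter_subset_right
        measure_ball_lt_top.ne
    _ = r ^ 2 * Real.pi := by
        rw [measureReal_def, EuclideanSpace.volume_ball_fin_two]
        simp [ENNReal.toReal_ofReal, hr, Real.pi_nonneg]
    _ ≤ _ := by nlinarith [Real.pi_le_four, sq_nonneg r]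

/-- The volume of `G` in `B_{2r}` is at most `4 (2r)²`, so the bump of radius `2r` gives `(9/16)
τ(B_r) ≤ 64 r`; the constant `200` leaves room. -/
lemma IsReducedPoint.exists_measure_ball_le [IsFiniteMeasure τ]
    (h : IsReducedPoint G τ x ν θ) (hG : MeasurableSet G) :
    ∃ r₀ > (0:ℝ), ∀ r, 0 < r → r < r₀ → τ.real (Metric.ball x r) ≤ 200 * r := by
  obtain ⟨r₀, hr₀, h1⟩ := h.exists_integral_quadBump_le hG
  refine ⟨r₀ / 2, by positivity, fun r hr hrr => ?_⟩
  have h2 := (h1 (2 * r) (by positivity) (by linarith)).1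
  have h3 := mul_measure_le_integral_quadBump τ x (r := 2 * r) (s := r) (by positivity) hr.le
    (by linarith)
  have h4 := volume_real_inter_ball_le G x (r := 2 * r) (by positivity)
  have h5 : r ^ 2 / (2 * r) ^ 2 = 1 / 4 := by field_simp; norm_num
  rw [h5] at h3
  have h6 : 8 / (2 * r) * volume.real (G ∩ Metric.ball x (2 * r)) ≤ 8 / (2 * r) * (4 * (2 * r) ^ 2) := by
    gcongr
  have h7 : 8 / (2 * r) * (4 * (2 * r) ^ 2) = 64 * r := by field_simp; norm_num
  linarith

lemma IsReducedPoint.exists_excess_ball_le [IsFiniteMeasure τ]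
    (h : IsReducedPoint G τ x ν θ) (hG : MeasurableSet G) {η : ℝ} (hη : 0 < η) :
    ∃ r₀ > (0:ℝ), ∀ r, 0 < r → r < r₀ → θ.real (Metric.ball x r) ≤ η * r := by
  obtain ⟨r₀, hr₀, h1⟩ := h.exists_measure_ball_le hG
  obtain ⟨r₁, hr₁, h2⟩ := h.excess (min (η / 200) (1 / 2)) (by positivity)
    ((min_le_right _ _).trans_lt (by norm_num))
  refine ⟨min r₀ r₁, by positivity, fun r hr hrr => ?_⟩
  have h3 := h1 r hr (hrr.trans_le (min_le_left _ _))
  have h4 := (h2 r hr (hrr.trans_le (min_le_right _ _))).2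
  calc _ ≤ min (η / 200) (1 / 2) * τ.real (Metric.ball x r) := h4
    _ ≤ η / 200 * (200 * r) := by gcongr; exact min_le_left _ _
    _ = η * r := by ring

end

/-- Density estimates at points of the reduced boundary, with a universal constant. -/
lemma exists_density_estimates : ∃ c > (0:ℝ), ∀ (G : Set Plane) (τ θ : Measure Plane) (x ν : Plane),
    MeasurableSet G → IsFiniteMeasure τ → VariationBound G τ → IsReducedPoint G τ x ν θ →
    ∃ r₀ > (0:ℝ), ∀ r, 0 < r → r < r₀ →
      c * r ^ 2 ≤ volume.real (G ∩ Metric.ball x r) ∧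
      c * r ^ 2 ≤ volume.real (Gᶜ ∩ Metric.ball x r) ∧
      c * r ≤ τ.real (Metric.ball x r) := by
  obtain ⟨c, hc, hV⟩ := exists_le_volume_ball
  refine ⟨min c (c ^ 2 / 96), by positivity, ?_⟩
  intro G τ θ x ν hG hτ hv h
  obtain ⟨r₀, hr₀, h1⟩ := h.exists_integral_quadBump_le hG
  have a1 : ∀ r, 0 < r → r < r₀ → c * r ^ 2 ≤ volume.real (G ∩ Metric.ball x r) :=
    fun r hr hrr => hV G τ x r hG hτ hv hr (fun s hs hsr => (h1 s hs (by linarith)).1)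
      fun s hs => h.measure_ball_pos hs
  have a2 : ∀ r, 0 < r → r < r₀ → c * r ^ 2 ≤ volume.real (Gᶜ ∩ Metric.ball x r) :=
    fun r hr hrr => hV Gᶜ τ x r hG.compl hτ (hv.compl hG) hr
      (fun s hs hsr => (h1 s hs (by linarith)).2) fun s hs => h.measure_ball_pos hs
  refine ⟨r₀, hr₀, fun r hr hrr => ⟨le_trans ?_ (a1 r hr hrr), le_trans ?_ (a2 r hr hrr), ?_⟩⟩
  · gcongr; exact min_le_left _ _
  · gcongr; exact min_le_left _ _
  -- The radius `r / 3` undoes the enlargement to `3R` and turns `c² / 32` into `c² / 96`.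
  · have := le_measure_ball_of_le_volume hG hv (R := r / 3) (by positivity) hc
      (a1 _ (by positivity) (by linarith)) (a2 _ (by positivity) (by linarith))
    rw [show 3 * (r / 3) = r by ring] at this
    refine le_trans ?_ this
    calc min c (c ^ 2 / 96) * r ≤ c ^ 2 / 96 * r := by gcongr; exact min_le_right _ _
      _ = _ := by ring

lemma FluxBound.mono {G : Set Plane} {e : Plane} {σ σ' : Measure Plane} [IsFiniteMeasure σ']
    (h : FluxBound G e σ) (hle : σ ≤ σ') : FluxBound G e σ' := by
  intro φ h1 h2 h3
  refine (h φ h1 h2 h3).trans (integral_mono_measure hle (Eventually.of_forall h3) ?_)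
  exact h1.continuous.integrable_of_hasCompactSupport h2

lemma Orthonormal.pair_neg {e ν : Plane} (h : Orthonormal ℝ ![e, ν]) : Orthonormal ℝ ![e, -ν] := by
  constructor
  · intro i
    have h0 := h.1 i
    fin_cases i <;> simpa using h0
  · intro i j hij
    have h0 := h.2 hij
    fin_cases i <;> fin_cases j <;> simp_all

section

variable {G : Set Plane} {τ θ : Measure Plane} {x e ν : Plane}

/-- The variation and the excess are unchanged and the normal is reversed, so facts about the outer
side also hold on the inner side. -/
lemma IsReducedPoint.compl (h : IsReducedPoint G τ x ν θ) (hG : MeasurableSet G) :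
    IsReducedPoint Gᶜ τ x (-ν) θ where
  norm_eq := by simpa using h.norm_eq
  finite := h.finite
  flux := h.flux.compl hG.nullMeasurableSet
  integral_eq φ h1 h2 := by
    rw [h.integral_eq φ h1 h2, setIntegral_compl_fderiv hG.nullMeasurableSet h1 h2]
    simp [integral_neg]
  tangential e he η hη := by
    have he' : Orthonormal ℝ ![e, ν] := by simpa using he.pair_neg
    obtain ⟨h1, h2⟩ := h.tangential e he' η hη
    exact ⟨by simpa using h2.compl hG.nullMeasurableSet, h1.compl hG.nullMeasurableSet⟩
  excess := h.excess

/-- A measure that is small near `x` and dominates the tangential and the upward flux. -/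
lemma IsReducedPoint.exists_small_flux [IsFiniteMeasure τ] (h : IsReducedPoint G τ x ν θ)
    (hG : MeasurableSet G) (he : Orthonormal ℝ ![e, ν]) {ε : ℝ} (hε : 0 < ε) :
    ∃ σ : Measure Plane, IsFiniteMeasure σ ∧ FluxBound G e σ ∧ FluxBound G (-e) σ ∧
      FluxBound G (-ν) σ ∧ ∃ r₀ > (0:ℝ), ∀ r, 0 < r → r < r₀ → σ.real (Metric.ball x r) ≤ ε * r := by
  have := h.finite
  -- With `τ(B_r) ≤ 200 r` this makes `η τ` half of the budget `ε r`. The smallness of `θ` is chosen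
  -- afterwards, so that `(η⁻¹ + 1) θ` takes the other half.
  set η : ℝ := ε / 400 with hη
  have hη0 : 0 < η := by positivity
  obtain ⟨h1, h2⟩ := h.tangential e he η hη0
  obtain ⟨r₀, hr₀, hτ⟩ := h.exists_measure_ball_le hG
  obtain ⟨r₁, hr₁, hθ⟩ := h.exists_excess_ball_le hG (η := ε / (2 * (η⁻¹ + 1))) (by positivity)
  set σ := η.toNNReal • τ + (η⁻¹).toNNReal • θ with hσ
  have hle1 : σ ≤ σ + θ := Measure.le_add_right le_rfl
  have hle2 : θ ≤ σ + θ := Measure.le_add_left le_rfl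
  refine ⟨σ + θ, inferInstance, h1.mono hle1, h2.mono hle1, h.flux.mono hle2, min r₀ r₁,
    by positivity, fun r hr hrr => ?_⟩
  have h3 := hτ r hr (hrr.trans_le (min_le_left _ _))
  have h4 := hθ r hr (hrr.trans_le (min_le_right _ _))
  rw [measureReal_add_apply, hσ, measureReal_add_apply, measureReal_nnreal_smul_apply,
    measureReal_nnreal_smul_apply, Real.coe_toNNReal _ hη0.le, Real.coe_toNNReal _ (by positivity)]
  have h5 : (η⁻¹ + 1) * θ.real (Metric.ball x r) ≤ (η⁻¹ + 1) * (ε / (2 * (η⁻¹ + 1)) * r) := by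
    gcongr
  have h6 : (η⁻¹ + 1) * (ε / (2 * (η⁻¹ + 1)) * r) = ε / 2 * r := by
    have : η⁻¹ + 1 ≠ 0 := by positivity
    field_simp
  have h7 : η * τ.real (Metric.ball x r) ≤ η * (200 * r) := by gcongr
  have h8 : η * (200 * r) = ε / 2 * r := by rw [hη]; ring
  linarith

lemma dist_frame_le (he : Orthonormal ℝ ![e, ν]) (p : ℝ × ℝ) :
    dist (frame x e ν p) x ≤ |p.1| + |p.2| := by
  have h := dist_frame_sq (x := x) he p (0, 0)
  have hfx : frame x e ν (0, 0) = x := by simp [frame]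
  rw [hfx, sub_zero, sub_zero] at h
  refine le_of_pow_le_pow_left₀ two_ne_zero (by positivity) ?_
  rw [h, add_sq, sq_abs, sq_abs]
  have := mul_nonneg (abs_nonneg p.1) (abs_nonneg p.2)
  linarith

lemma abs_sub_le_dist_frame (he : Orthonormal ℝ ![e, ν]) (p q : ℝ × ℝ) :
    |p.1 - q.1| ≤ dist (frame x e ν p) (frame x e ν q) ∧
    |p.2 - q.2| ≤ dist (frame x e ν p) (frame x e ν q) := by
  have h := dist_frame_sq (x := x) he p q
  constructor
  · refine le_of_pow_le_pow_left₀ two_ne_zero (by positivity) ?_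
    rw [h, sq_abs]; linarith [sq_nonneg (p.2 - q.2)]
  · refine le_of_pow_le_pow_left₀ two_ne_zero (by positivity) ?_
    rw [h, sq_abs]; linarith [sq_nonneg (p.1 - q.1)]

/-! ### Flatness of the boundary at a reduced boundary point -/

lemma measurableSet_inner_ge (ν x : Plane) (t : ℝ) : MeasurableSet {z : Plane | t ≤ inner ℝ ν (z - x)} :=
  (isClosed_le continuous_const (by fun_prop)).measurableSet

/-- Near `x`, the set `G` occupies little volume above the tangent line. -/
lemma IsReducedPoint.exists_volume_above_le [IsFiniteMeasure τ] (h : IsReducedPoint G τ x ν θ)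
    (hG : MeasurableSet G) (hv : VariationBound G τ) {ε : ℝ} (hε : 0 < ε) :
    ∃ R₀ > (0:ℝ), ∀ R, 0 < R → R < R₀ →
      volume.real (G ∩ Metric.ball x R ∩ {z | R / 8 ≤ inner ℝ ν (z - x)}) ≤ ε * R ^ 2 := by
  obtain ⟨e, he⟩ := exists_orthonormal_pair h.norm_eq
  obtain ⟨c, hc, hd⟩ := exists_density_estimates
  obtain ⟨r₁, hr₁, hd⟩ := hd G τ θ x ν hG inferInstance hv h
  obtain ⟨σ, _, f1, f2, f3, r₂, hr₂, hσ⟩ := h.exists_small_flux hG he (ε := ε * c / (72 * 64))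
    (by positivity)
  refine ⟨min r₁ (r₂ / 3), by positivity, fun R hR hRR => ?_⟩
  have hR1 : R < r₁ := hRR.trans_le (min_le_left _ _)
  have hR2 : 3 * R < r₂ := by have := hRR.trans_le (min_le_right _ _); linarith
  have hmp := measurePreserving_frame (x := x) he
  have hfx : frame x e ν (0, 0) = x := by simp [frame]
  have hsub : ∀ p : ℝ × ℝ, frame x e ν p ∈ Metric.ball x R →
      p ∈ Set.Icc (-R) (-R + 2 * R) ×ˢ Set.Icc (-R) (-R + 2 * R) := by
    intro p hp
    have h := abs_sub_le_dist_frame (x := x) he p (0, 0)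
    rw [hfx, sub_zero, sub_zero, abs_le, abs_le] at h
    rw [Metric.mem_ball] at hp
    exact ⟨⟨by linarith, by linarith⟩, by linarith, by linarith⟩
  set A := G ∩ Metric.ball x R ∩ {z | R / 8 ≤ inner ℝ ν (z - x)} with hA
  have mA : MeasurableSet A := (hG.inter measurableSet_ball).inter (measurableSet_inner_ge ν x _)
  have mB : MeasurableSet (Gᶜ ∩ Metric.ball x (R / 8)) := hG.compl.inter measurableSet_ball
  -- The complement has volume at least `c (R/8)²` in `B_{R/8}`, all of it below `A`. Since `G`
  -- above `Gᶜ` costs only flux dominated by `σ`, the product of the volumes is at most `24 R³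
  -- σ(B_{3R})`.
  have key := volume_mul_volume_le_of_above (x := x) (σ₁ := σ) (σ₂ := σ) (P := frame x e ν ⁻¹' A)
    (N := frame x e ν ⁻¹' (Gᶜ ∩ Metric.ball x (R / 8))) (s := -R) (a := 2 * R) (b := 2 * R)
    (u₁ := -R) (u₂ := -R) (j₀ := -R) (j₁ := -R + 2 * R)
    (U := Metric.ball x (3 * R)) (δ := R) he hG f1 f2 f3 (hmp.measurable mA) (hmp.measurable mB)
    (fun p hp => hp.1.1) (fun p hp => hp.1) (fun p hp => hsub p hp.1.2)
    (fun p hp => hsub p (Metric.ball_subset_ball (by linarith) hp.2)) ?_ le_rfl le_rfl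
    measurableSet_ball hR ?_
  · rw [hmp.measure_preimage mA.nullMeasurableSet, hmp.measure_preimage mB.nullMeasurableSet] at key
    have hAfin : volume A ≠ ⊤ :=
      ((measure_mono (Set.inter_subset_left.trans Set.inter_subset_right)).trans_lt
        (measure_ball_lt_top (x := x) (r := R))).ne
    have k2 := ENNReal.toReal_mono (by finiteness) key
    rw [ENNReal.toReal_add (by finiteness) (by finiteness)] at k2
    simp only [ENNReal.toReal_mul, ENNReal.toReal_ofReal (show 0 ≤ 2 * R by linarith),
      ENNReal.toReal_ofNat] at k2
    have h1 := hσ (3 * R) (by positivity) hR2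
    have h2 := (hd (R / 8) (by positivity) (by linarith)).2.1
    simp only [measureReal_def] at h1 h2 ⊢
    have h3 : (volume A).toReal * (c * (R / 8) ^ 2) ≤ 24 * R ^ 3 * (ε * c / (72 * 64) * (3 * R)) := by
      calc _ ≤ (volume A).toReal * (volume (Gᶜ ∩ Metric.ball x (R / 8))).toReal := by gcongr
        _ ≤ 24 * R ^ 3 * (σ (Metric.ball x (3 * R))).toReal := by nlinarith [k2]
        _ ≤ _ := by gcongr
    have h4 : 24 * R ^ 3 * (ε * c / (72 * 64) * (3 * R)) = ε * R ^ 2 * (c * (R / 8) ^ 2) := by ring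
    rw [h4] at h3
    exact le_of_mul_le_mul_right h3 (by positivity)
  · intro p hp q hq
    have h1 : R / 8 ≤ p.2 := by
      have := hp.2
      simpa only [Set.mem_ofPred_eq, inner_frame_snd he] using this
    have h2 := (abs_sub_le_dist_frame (x := x) he q (0, 0)).2
    have h3 := hq.2
    rw [hfx, sub_zero, abs_le] at h2
    rw [Metric.mem_ball] at h3
    linarith
  · rintro p ⟨⟨a1, a2⟩, a3, a4⟩
    apply Metric.ball_subset_ball'
    have h := dist_frame_sq (x := x) he p (0, 0)
    rw [hfx, sub_zero, sub_zero] at h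
    have : dist (frame x e ν p) x ≤ 2 * R := by
      refine le_of_pow_le_pow_left₀ two_ne_zero (by positivity) ?_
      rw [h]; nlinarith
    linarith

/-- The variation has small density away from the tangent line. -/
lemma IsReducedPoint.exists_measure_ball_above_le [IsFiniteMeasure τ]
    (h : IsReducedPoint G τ x ν θ) (hG : MeasurableSet G) (hv : VariationBound G τ) {ε : ℝ}
    (hε : 0 < ε) :
    ∃ R₀ > (0:ℝ), ∀ R, 0 < R → R < R₀ → ∀ z, dist z x ≤ 7 / 8 * R → R / 4 ≤ inner ℝ ν (z - x) →
      τ.real (Metric.ball z (R / 16)) ≤ ε * R := by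
  have := h.finite
  obtain ⟨r₁, hr₁, h1⟩ := h.exists_volume_above_le hG hv (ε := ε / 60) (by positivity)
  obtain ⟨r₂, hr₂, h2⟩ := h.exists_excess_ball_le hG (η := ε / 60) (by positivity)
  refine ⟨min r₁ r₂, by positivity, fun R hR hRR z hz hzν => ?_⟩
  have h1 := h1 R hR (hRR.trans_le (min_le_left _ _))
  have h2 := h2 R hR (hRR.trans_le (min_le_right _ _))
  have hsub : Metric.ball z (R / 8) ⊆ Metric.ball x R :=
    Metric.ball_subset_ball' (by linarith)
  -- The ball `B_{R/8}(z)` stays above height `R / 8`, where `G` has little volume; so both the flux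
  -- and the excess in this identity are small.
  have h3 := h.integral_eq _ (contDiff_quadBump z (R / 8))
    (hasCompactSupport_quadBump z (by positivity))
  have h4 := (integral_quadBump_le θ z (r := R / 8) (by positivity)).trans (measureReal_mono hsub)
  have h5 := setIntegral_fderiv_quadBump_le G z (r := R / 8) (by positivity) h.norm_eq.le
  have h6 := mul_measure_le_integral_quadBump τ z (r := R / 8) (s := R / 16) (by positivity)
    (by positivity) (by linarith)
  have h7 : (R / 16) ^ 2 / (R / 8) ^ 2 = 1 / 4 := by field_simp; norm_num
  rw [h7] at h6
  have h8 : volume.real (G ∩ Metric.ball z (R / 8)) ≤ ε / 60 * R ^ 2 := by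
    refine le_trans (measureReal_mono ?_ ?_) h1
    · intro w hw
      refine ⟨⟨hw.1, hsub hw.2⟩, ?_⟩
      have e1 : inner ℝ ν (w - x) = inner ℝ ν (z - x) - inner ℝ ν (z - w) := by
        rw [← inner_sub_right]; congr 1; abel
      have e2 : inner ℝ ν (z - w) ≤ R / 8 := by
        refine (real_inner_le_norm _ _).trans ?_
        rw [h.norm_eq, one_mul, ← dist_eq_norm, dist_comm]
        exact (Metric.mem_ball.1 hw.2).le
      rw [Set.mem_ofPred_eq, e1]; linarith
    · exact ((measure_mono (Set.inter_subset_left.trans Set.inter_subset_right)).trans_lt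
        (measure_ball_lt_top (x := x) (r := R))).ne
  have h9 : 4 / (R / 8) * volume.real (G ∩ Metric.ball z (R / 8)) ≤ 4 / (R / 8) * (ε / 60 * R ^ 2) := by
    gcongr
  have h10 : 4 / (R / 8) * (ε / 60 * R ^ 2) = 32 / 60 * ε * R := by field_simp; norm_num
  nlinarith [mul_pos hε hR]

/-- Flatness: a set along which the variation has positive lower density stays out of a sector
around the normal direction. -/
lemma IsReducedPoint.exists_no_point_in_sector [IsFiniteMeasure τ]
    (h : IsReducedPoint G τ x ν θ) (hG : MeasurableSet G) (hv : VariationBound G τ)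
    (he : Orthonormal ℝ ![e, ν]) {Γ : Set Plane} {C r₀ : ℝ} (hC : 0 < C) (hr₀ : 0 < r₀)
    (hΓ : ∀ z ∈ Γ, ∀ r, 0 < r → r < r₀ → C * r ≤ τ.real (Metric.ball z r)) :
    ∃ R₀ > (0:ℝ), ∀ p : ℝ × ℝ, p ≠ 0 → p.2 < R₀ → |p.1| ≤ 2 * p.2 → frame x e ν p ∉ Γ := by
  obtain ⟨R₁, hR₁, h1⟩ := h.exists_measure_ball_above_le hG hv (ε := C / 32) (by positivity)
  refine ⟨min R₁ r₀ / 4, by positivity, fun p hp hp2 hp1 hpΓ => ?_⟩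
  have hpos : 0 < p.2 := by
    by_contra! hle
    have h0 := abs_nonneg p.1
    have h2 : p.2 = 0 := by linarith
    have h3 : p.1 = 0 := by rw [← abs_eq_zero]; linarith
    exact hp (Prod.ext h3 h2)
  have m1 := min_le_left R₁ r₀
  have m2 := min_le_right R₁ r₀
  have hfx : frame x e ν (0, 0) = x := by simp [frame]
  -- At scale `R = 4 p.2` the point has height `R / 4` and distance at most `√5 R / 4` from `x`.
  -- There `τ(B_{R/16}) ≤ C R / 32`, whereas the lower density requires `C R / 16`.
  have h2 := h1 (4 * p.2) (by positivity) (by linarith) (frame x e ν p) ?_ ?_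
  · have h3 := hΓ _ hpΓ (4 * p.2 / 16) (by positivity) (by linarith)
    nlinarith
  · have h := dist_frame_sq (x := x) he p (0, 0)
    rw [hfx, sub_zero, sub_zero] at h
    refine le_of_pow_le_pow_left₀ two_ne_zero (by positivity) ?_
    rw [h]
    have := sq_le_sq' (by linarith [neg_abs_le p.1]) ((le_abs_self p.1).trans hp1)
    nlinarith
  · rw [inner_frame_snd he]; linarith

end

/-! ### Columns with two reduced boundary points -/

/-- Columns meeting the reduced boundary twice: their abscissae form a set of small measure. -/
lemma exists_volume_columns_le : ∃ K > (0:ℝ), ∀ (G : Set Plane) (τ σ : Measure Plane)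
    (x e ν : Plane) (R : ℝ), MeasurableSet G → IsFiniteMeasure τ → VariationBound G τ →
    IsFiniteMeasure σ → FluxBound G e σ → FluxBound G (-e) σ → FluxBound G (-ν) σ →
    Orthonormal ℝ ![e, ν] → 0 < R →
    volume {s : ℝ | |s| ≤ R ∧ ∃ b₁ b₂ : ℝ, b₁ < b₂ ∧ |b₁| ≤ R ∧ |b₂| ≤ R ∧
      (∃ ν' θ', IsReducedPoint G τ (frame x e ν (s, b₁)) ν' θ') ∧
      (∃ ν' θ', IsReducedPoint G τ (frame x e ν (s, b₂)) ν' θ')} ≤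
    ENNReal.ofReal K * σ (Metric.ball x (4 * R)) := by
  obtain ⟨c, hc, hd⟩ := exists_density_estimates
  refine ⟨10 / (c ^ 2 / 48), by positivity, ?_⟩
  intro G τ σ x e ν R hG hτ hv hσ f1 f2 f3 he hR
  have hcont : Continuous fun z : Plane => (inner ℝ e (z - x) : ℝ) := by fun_prop
  rw [← MeasureTheory.hausdorffMeasure_real]
  -- The projection of `σ` to the `e`-axis has positive lower density at each such abscissa: `G`
  -- fills area `c ρ²` near the upper point and `Gᶜ` does so near the lower one. Hence `(c ρ²)² ≤ 24
  -- ρ³ σ(strip)`, and the strip has half-width `2ρ`.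
  refine (hausdorffMeasure_le_of_density
    ((σ.restrict (Metric.ball x (4 * R))).map fun z => inner ℝ e (z - x)) (U := Set.univ)
    (c := c ^ 2 / 48) (by positivity) ?_).trans ?_
  swap
  · rw [Measure.map_apply hcont.measurable MeasurableSet.univ]; simp
  rintro s ⟨hs, b₁, b₂, hb, hb₁, hb₂, ⟨ν₁, θ₁, h₁⟩, ν₂, θ₂, h₂⟩ ε hε
  obtain ⟨r₁, hr₁, d₁⟩ := hd G τ θ₁ _ ν₁ hG hτ hv h₁
  obtain ⟨r₂, hr₂, d₂⟩ := hd G τ θ₂ _ ν₂ hG hτ hv h₂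
  -- The bound by half of `b₂ − b₁` keeps one ball above the other; the bound by `R / 2` keeps the
  -- enlarged rectangle in `B_{4R}(x)`.
  obtain ⟨ρ, hρ, hρlt⟩ := exists_between (show 0 < min (min r₁ r₂) (min (ε / 2) (min (R / 2) ((b₂ - b₁) / 2)))
    by have : 0 < b₂ - b₁ := by linarith
       positivity)
  simp only [lt_min_iff] at hρlt
  obtain ⟨⟨l1, l2⟩, l3, l4, l5⟩ := hρlt
  have d₁ := (d₁ ρ hρ l1).2.1
  have d₂ := (d₂ ρ hρ l2).1
  refine ⟨2 * ρ, by positivity, by linarith, Set.subset_univ _, ?_⟩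
  rw [Measure.map_apply hcont.measurable Metric.isClosed_closedBall.measurableSet,
    Measure.restrict_apply (hcont.measurable Metric.isClosed_closedBall.measurableSet)]
  set U := (fun z : Plane => (inner ℝ e (z - x) : ℝ)) ⁻¹' Metric.closedBall s (2 * ρ) ∩
    Metric.ball x (4 * R) with hUdef
  have hU : MeasurableSet U :=
    (hcont.measurable Metric.isClosed_closedBall.measurableSet).inter measurableSet_ball
  have hmp := measurePreserving_frame (x := x) he
  have mP : MeasurableSet (G ∩ Metric.ball (frame x e ν (s, b₂)) ρ) := hG.inter measurableSet_ball
  have mN : MeasurableSet (Gᶜ ∩ Metric.ball (frame x e ν (s, b₁)) ρ) :=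
    hG.compl.inter measurableSet_ball
  have hbox : ∀ (b : ℝ) (p : ℝ × ℝ), frame x e ν p ∈ Metric.ball (frame x e ν (s, b)) ρ →
      p ∈ Set.Icc (s - ρ) (s - ρ + 2 * ρ) ×ˢ Set.Icc (b - ρ) (b - ρ + 2 * ρ) := by
    intro b p hp
    have h := abs_sub_le_dist_frame (x := x) he p (s, b)
    rw [abs_le, abs_le] at h
    rw [Metric.mem_ball] at hp
    exact ⟨⟨by linarith, by linarith⟩, by linarith, by linarith⟩
  rw [abs_le] at hb₁ hb₂ hs
  have key := volume_mul_volume_le_of_above (x := x) (σ₁ := σ) (σ₂ := σ)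
    (P := frame x e ν ⁻¹' (G ∩ Metric.ball (frame x e ν (s, b₂)) ρ))
    (N := frame x e ν ⁻¹' (Gᶜ ∩ Metric.ball (frame x e ν (s, b₁)) ρ))
    (s := s - ρ) (a := 2 * ρ) (b := 2 * ρ) (u₁ := b₂ - ρ) (u₂ := b₁ - ρ) (j₀ := -(2 * R))
    (j₁ := 2 * R) (U := U) (δ := ρ) he hG f1 f2 f3 (hmp.measurable mP) (hmp.measurable mN)
    (fun p hp => hp.1) (fun p hp => hp.1) (fun p hp => hbox _ p hp.2) (fun p hp => hbox _ p hp.2)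
    ?_ (Set.Icc_subset_Icc (by linarith) (by linarith))
    (Set.Icc_subset_Icc (by linarith) (by linarith)) hU hρ ?_
  · rw [hmp.measure_preimage mP.nullMeasurableSet, hmp.measure_preimage mN.nullMeasurableSet] at key
    have k2 := ENNReal.toReal_mono (by finiteness) key
    rw [ENNReal.toReal_add (by finiteness) (by finiteness)] at k2
    simp only [ENNReal.toReal_mul, ENNReal.toReal_ofReal (show 0 ≤ 2 * ρ by linarith),
      ENNReal.toReal_ofNat] at k2
    simp only [measureReal_def] at d₁ d₂
    rw [ENNReal.ofReal_le_iff_le_toReal (measure_ne_top σ U)]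
    have h3 : (c * ρ ^ 2) * (c * ρ ^ 2) ≤ 24 * ρ ^ 3 * (σ U).toReal :=
      (mul_le_mul d₂ d₁ (by positivity) (by positivity)).trans (by nlinarith [k2])
    have h4 : 24 * ρ ^ 3 * (c ^ 2 / 48 * (2 * ρ)) ≤ 24 * ρ ^ 3 * (σ U).toReal := by nlinarith [h3]
    exact le_of_mul_le_mul_left h4 (by positivity)
  · intro p hp q hq
    have h1 := (hbox _ p hp.2).2.1
    have h2 := (hbox _ q hq.2).2.2
    linarith
  · rintro p ⟨⟨a1, a2⟩, a3, a4⟩ z hz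
    obtain ⟨q, rfl⟩ : ∃ q, frame x e ν q = z := ⟨_, frame_inner he z⟩
    rw [Metric.mem_ball] at hz
    have h1 := abs_sub_le_dist_frame (x := x) he q p
    rw [abs_le, abs_le] at h1
    have h2 := dist_frame_le (x := x) he p
    have h3 : |p.1| ≤ R + ρ := abs_le.2 ⟨by linarith, by linarith⟩
    have h4 : |p.2| ≤ 2 * R := abs_le.2 ⟨by linarith, by linarith⟩
    refine ⟨?_, ?_⟩
    · rw [Set.mem_preimage, inner_frame_fst he, Metric.mem_closedBall, Real.dist_eq, abs_le]
      exact ⟨by linarith, by linarith⟩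
    · rw [Metric.mem_ball]
      have := dist_triangle (frame x e ν q) (frame x e ν p) x
      linarith

/-! ### Connected components and sectors -/

lemma IsPreconnected.subset_or_subset_compl_of_disjoint_frontier {X : Type*} [TopologicalSpace X]
    {s t : Set X} (hs : IsPreconnected s) (h : ∀ z ∈ s, z ∉ frontier t) : s ⊆ t ∨ s ⊆ tᶜ := by
  have hcov : s ⊆ interior t ∪ (closure t)ᶜ := by
    intro z hz
    by_cases hzc : z ∈ closure t
    · left; by_contra hzi; exact h z hz ⟨hzc, hzi⟩
    · exact Or.inr hzc
  rcases hs.subset_or_subset isOpen_interior isClosed_closure.isOpen_compl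
    (Set.disjoint_compl_right_iff_subset.2 (interior_subset.trans subset_closure)) hcov with h1 | h1
  · exact Or.inl (h1.trans interior_subset)
  · exact Or.inr (h1.trans (Set.compl_subset_compl.2 subset_closure))

lemma IsConnectedComponentOf.subset_of_inter_nonempty {X : Type*} [TopologicalSpace X]
    {A S T : Set X} (hA : IsConnectedComponentOf A S) (hT : IsPreconnected T) (hTS : T ⊆ S)
    (h : (T ∩ A).Nonempty) : T ⊆ A := by
  obtain ⟨x, hx, rfl⟩ := hA
  obtain ⟨y, hyT, hyA⟩ := h
  rw [connectedComponentIn_eq hyA]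
  exact hT.subset_connectedComponentIn hyT hTS

lemma IsConnectedComponentOf.eq_of_inter_nonempty {X : Type*} [TopologicalSpace X]
    {A A' S : Set X} (hA : IsConnectedComponentOf A S) (hA' : IsConnectedComponentOf A' S)
    (h : (A ∩ A').Nonempty) : A = A' := by
  obtain ⟨x, hx, rfl⟩ := hA
  obtain ⟨x', hx', rfl⟩ := hA'
  obtain ⟨y, hy, hy'⟩ := h
  rw [connectedComponentIn_eq hy, connectedComponentIn_eq hy']

lemma IsConnectedComponentOf.subset {X : Type*} [TopologicalSpace X]
    {A S : Set X} (hA : IsConnectedComponentOf A S) : A ⊆ S := by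
  obtain ⟨x, hx, rfl⟩ := hA
  exact connectedComponentIn_subset S x

lemma IsConnectedComponentOf.isPreconnected {X : Type*} [TopologicalSpace X]
    {A S : Set X} (hA : IsConnectedComponentOf A S) : IsPreconnected A := by
  obtain ⟨x, hx, rfl⟩ := hA
  exact isPreconnected_connectedComponentIn

lemma IsConnectedComponentOf.nonempty {X : Type*} [TopologicalSpace X]
    {A S : Set X} (hA : IsConnectedComponentOf A S) : A.Nonempty := by
  obtain ⟨x, hx, rfl⟩ := hA
  exact ⟨x, mem_connectedComponentIn hx⟩

/-- The open sector of aperture `2` and height `R` around the positive vertical axis. -/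
def sector (R : ℝ) : Set (ℝ × ℝ) := {p | 0 < p.2 ∧ p.2 < R ∧ |p.1| ≤ 2 * p.2}

lemma convex_sector (R : ℝ) : Convex ℝ (sector R) := by
  rintro ⟨a, b⟩ ⟨h1, h2, h3⟩ ⟨a', b'⟩ ⟨h1', h2', h3'⟩ s t hs ht hst
  simp only at h1 h2 h3 h1' h2' h3'
  rw [abs_le] at h3 h3'
  refine ⟨?_, ?_, ?_⟩
  · simp only [Prod.smul_mk, Prod.mk_add_mk, smul_eq_mul]
    rcases hs.eq_or_lt with rfl | hs'
    · have : t = 1 := by linarith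
      simp [this, h1']
    · have := mul_pos hs' h1
      have := mul_nonneg ht h1'.le
      linarith
  · simp only [Prod.smul_mk, Prod.mk_add_mk, smul_eq_mul]
    rcases hs.eq_or_lt with rfl | hs'
    · have : t = 1 := by linarith
      simp [this, h2']
    · have h4 := mul_lt_mul_of_pos_left h2 hs'
      have h5 := mul_le_mul_of_nonneg_left h2'.le ht
      have h6 : s * R + t * R = R := by rw [← add_mul, hst, one_mul]
      linarith
  · simp only [Prod.smul_mk, Prod.mk_add_mk, smul_eq_mul]
    rw [abs_le]
    constructor <;> nlinarith [mul_le_mul_of_nonneg_left h3.1 hs, mul_le_mul_of_nonneg_left h3.2 hs,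
      mul_le_mul_of_nonneg_left h3'.1 ht, mul_le_mul_of_nonneg_left h3'.2 ht]

lemma isPreconnected_frame_sector (x e ν : Plane) (R : ℝ) :
    IsPreconnected (frame x e ν '' sector R) :=
  (convex_sector R).isPreconnected.image _ continuous_frame.continuousOn

section

variable {G Ω : Set Plane} {τ θ : Measure Plane} {x e ν : Plane}

/-- Near a point of the reduced boundary the outer sector does not meet `Ω`. -/
lemma IsReducedPoint.exists_sector_disjoint [IsFiniteMeasure τ]
    (h : IsReducedPoint G τ x ν θ) (hG : MeasurableSet G) (hv : VariationBound G τ)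
    (hGΩ : G =ᵐ[volume] Ω) (he : Orthonormal ℝ ![e, ν]) {C r₀ : ℝ} (hC : 0 < C) (hr₀ : 0 < r₀)
    (hΓ : ∀ z ∈ frontier Ω, ∀ r, 0 < r → r < r₀ → C * r ≤ τ.real (Metric.ball z r)) :
    ∃ R₀ > (0:ℝ), frame x e ν '' sector R₀ ⊆ Ωᶜ := by
  obtain ⟨R₁, hR₁, h1⟩ := h.exists_no_point_in_sector hG hv he hC hr₀ hΓ
  obtain ⟨R₂, hR₂, h2⟩ := h.exists_volume_above_le hG hv (ε := 1 / 64) (by norm_num)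
  refine ⟨R₁, hR₁, ?_⟩
  -- The connected sector misses the frontier, so it lies in `Ω` or outside. If inside, a ball of
  -- radius `R / 8` at height `R / 2` would have area `π R² / 64`, more than the `R² / 64`
  -- available.
  refine ((isPreconnected_frame_sector x e ν R₁).subset_or_subset_compl_of_disjoint_frontier
    (t := Ω) ?_).resolve_left fun hsub => ?_
  · rintro _ ⟨p, ⟨hp1, hp2, hp3⟩, rfl⟩
    refine h1 p (fun h0 => ?_) hp2 hp3
    rw [h0] at hp1; simp at hp1
  obtain ⟨R, hR, hRlt⟩ := exists_between (lt_min hR₁ hR₂)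
  have h3 := h2 R hR (hRlt.trans_le (min_le_right _ _))
  have hR1 := hRlt.trans_le (min_le_left R₁ R₂)
  set z := frame x e ν (0, R / 2) with hz
  have hball : Metric.ball z (R / 8) ⊆
      Ω ∩ (Metric.ball x R ∩ {z | R / 8 ≤ inner ℝ ν (z - x)}) := by
    intro w hw
    obtain ⟨q, rfl⟩ : ∃ q, frame x e ν q = w := ⟨_, frame_inner he w⟩
    rw [Metric.mem_ball] at hw
    have h4 := abs_sub_le_dist_frame (x := x) he q (0, R / 2)
    rw [abs_le, abs_le] at h4
    have h5 := dist_frame_le (x := x) he q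
    have h6 : |q.1| ≤ R / 8 := abs_le.2 ⟨by linarith, by linarith⟩
    have h7 : |q.2| ≤ 5 * R / 8 := abs_le.2 ⟨by linarith, by linarith⟩
    refine ⟨hsub ⟨q, ⟨by linarith, by linarith, by linarith⟩, rfl⟩, ?_, ?_⟩
    · rw [Metric.mem_ball]; linarith
    · rw [Set.mem_ofPred_eq, inner_frame_snd he]; linarith
  have h4 : volume (G ∩ Metric.ball x R ∩ {z | R / 8 ≤ inner ℝ ν (z - x)}) =
      volume (Ω ∩ (Metric.ball x R ∩ {z | R / 8 ≤ inner ℝ ν (z - x)})) := by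
    rw [Set.inter_assoc]
    exact measure_congr (hGΩ.inter (ae_eq_refl _))
  have h5 := measureReal_mono (μ := volume) hball (((measure_mono (Set.inter_subset_right.trans
    Set.inter_subset_left)).trans_lt (measure_ball_lt_top (x := x) (r := R))).ne)
  rw [measureReal_def, measureReal_def, ← h4, EuclideanSpace.volume_ball_fin_two] at h5
  rw [measureReal_def] at h3
  have h6 := h5.trans h3
  simp only [ENNReal.toReal_mul, ENNReal.toReal_pow, ENNReal.toReal_ofReal (show 0 ≤ R / 8 by linarith),
    ENNReal.toReal_ofReal Real.pi_pos.le] at h6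
  nlinarith [Real.pi_gt_three, pow_pos hR 2]

/-- A vertical segment with one endpoint in `Ω` and the other outside meets the boundary. -/
lemma exists_frontier_on_segment {t u v : ℝ} (huv : u ≤ v)
    (h : frame x e ν (t, u) ∈ Ω ∧ frame x e ν (t, v) ∉ Ω ∨
      frame x e ν (t, u) ∉ Ω ∧ frame x e ν (t, v) ∈ Ω) :
    ∃ b ∈ Set.Icc u v, frame x e ν (t, b) ∈ frontier Ω := by
  have hpre : IsPreconnected ((fun b => frame x e ν (t, b)) '' Set.Icc u v) :=
    isPreconnected_Icc.image _ (continuous_frame.comp (by fun_prop)).continuousOn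
  by_contra! hno
  have hu : frame x e ν (t, u) ∈ (fun b => frame x e ν (t, b)) '' Set.Icc u v :=
    ⟨u, ⟨le_rfl, huv⟩, rfl⟩
  have hv : frame x e ν (t, v) ∈ (fun b => frame x e ν (t, b)) '' Set.Icc u v :=
    ⟨v, ⟨huv, le_rfl⟩, rfl⟩
  rcases hpre.subset_or_subset_compl_of_disjoint_frontier (t := Ω)
    (by rintro _ ⟨b, hb, rfl⟩; exact hno b hb) with h1 | h1
  · rcases h with h | h
    · exact h.2 (h1 hv)
    · exact h.1 (h1 hu)
  · rcases h with h | h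
    · exact h1 hu h.1
    · exact h1 hv h.2

lemma frame_neg_snd (p : ℝ × ℝ) : frame x e (-ν) p = frame x e ν (p.1, -p.2) := by
  simp [frame]

/-- A component of `Ω` accumulating at `x` but avoiding the inner sector forces vertical lines close
to `x` to meet the boundary of `Ω` twice. -/
lemma exists_two_frontier_points (he : Orthonormal ℝ ![e, ν]) {R : ℝ} (hR : 0 < R)
    (hup : frame x e ν '' sector R ⊆ Ωᶜ) (hlow : frame x e (-ν) '' sector R ⊆ Ω) {A : Set Plane}
    (hA : IsConnectedComponentOf A Ω) (hxA : x ∈ closure A)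
    (hdisj : ¬ (frame x e (-ν) '' sector R ∩ A).Nonempty) :
    ∃ ρ > (0:ℝ), ∀ s, 0 < s → s < ρ → ∃ t, |t| = s ∧ ∃ b₁ b₂ : ℝ, b₁ < b₂ ∧ |b₁| ≤ s ∧ |b₂| ≤ s ∧
      frame x e ν (t, b₁) ∈ frontier Ω ∧ frame x e ν (t, b₂) ∈ frontier Ω := by
  have hlowmem : ∀ a b : ℝ, b < 0 → -R < b → |a| ≤ 2 * -b →
      frame x e ν (a, b) ∈ frame x e (-ν) '' sector R := fun a b h1 h2 h3 =>
    ⟨(a, -b), ⟨by simpa, by simp only; linarith, h3⟩, by simp [frame_neg_snd]⟩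
  have hLpre := isPreconnected_frame_sector x e (-ν) R
  have hfx : frame x e ν (0, 0) = x := by simp [frame]
  have hxL : x ∈ closure (frame x e (-ν) '' sector R) := by
    have hc : Tendsto (fun b : ℝ => frame x e ν (0, b)) (𝓝[<] 0) (𝓝 (frame x e ν (0, 0))) :=
      ((continuous_frame.comp (by fun_prop : Continuous fun b : ℝ => ((0:ℝ), b))).tendsto 0).mono_left
        nhdsWithin_le_nhds
    rw [hfx] at hc
    refine mem_closure_of_tendsto hc ?_
    filter_upwards [Ioo_mem_nhdsLT (show -R < 0 by linarith)] with b hb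
    exact hlowmem 0 b hb.2 hb.1 (by simp; linarith [hb.2])
  -- Adjoining `x` to the inner sector keeps it connected, so `x ∈ A` would put the whole sector in
  -- `A`.
  have hxnA : x ∉ A := by
    intro hx
    have hpre : IsPreconnected (insert x (frame x e (-ν) '' sector R)) :=
      hLpre.subset_closure (Set.subset_insert _ _)
        (Set.insert_subset hxL subset_closure)
    have hsub := hA.subset_of_inter_nonempty hpre (Set.insert_subset (hA.subset hx) hlow)
      ⟨x, Set.mem_insert _ _, hx⟩
    refine hdisj ⟨frame x e ν (0, -(R / 2)), hlowmem 0 _ (by linarith) (by linarith)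
      (by simp; linarith), hsub (Set.mem_insert_of_mem _ (hlowmem 0 _ (by linarith) (by linarith)
      (by simp; linarith)))⟩
  -- Level sets of `g` are boundaries of squares about `x`. The connected set `A` accumulates at `x`
  -- and contains another point, so it meets every small one.
  set g : Plane → ℝ := fun z => max |inner ℝ e (z - x)| |inner ℝ ν (z - x)| with hg
  have hgc : Continuous g := by
    simp only [hg]; fun_prop
  have hgx : g x = 0 := by simp [hg]
  obtain ⟨a, ha⟩ := hA.nonempty
  have hga : 0 < g a := by
    by_contra! hle
    have h1 : inner ℝ e (a - x) = (0:ℝ) := abs_eq_zero.1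
      (le_antisymm ((le_max_left _ _).trans hle) (abs_nonneg _))
    have h2 : inner ℝ ν (a - x) = (0:ℝ) := abs_eq_zero.1
      (le_antisymm ((le_max_right _ _).trans hle) (abs_nonneg _))
    have h3 := frame_inner (x := x) he a
    rw [h1, h2, hfx] at h3
    exact hxnA (h3 ▸ ha)
  refine ⟨min (g a) R, by positivity, fun s hs hslt => ?_⟩
  obtain ⟨hs1, hs2⟩ := lt_min_iff.1 hslt
  obtain ⟨a', ha', hga'⟩ : ∃ a' ∈ A, g a' < s := by
    have hopen : g ⁻¹' Set.Iio s ∈ 𝓝 x := hgc.continuousAt.preimage_mem_nhds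
      (by rw [hgx]; exact Iio_mem_nhds hs)
    obtain ⟨a', h1, h2⟩ := mem_closure_iff_nhds.1 hxA _ hopen
    exact ⟨a', h2, h1⟩
  obtain ⟨z, hzA, hgz⟩ : s ∈ g '' A :=
    (hA.isPreconnected.image g hgc.continuousOn).ordConnected.out ⟨a', ha', rfl⟩ ⟨a, ha, rfl⟩
      ⟨hga'.le, hs1.le⟩
  obtain ⟨p, rfl⟩ : ∃ p, frame x e ν p = z := ⟨_, frame_inner he z⟩
  simp only [hg, inner_frame_fst he, inner_frame_snd he] at hgz
  obtain ⟨t, y⟩ := p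
  simp only at hgz
  have hts : |t| ≤ s := hgz ▸ le_max_left _ _
  have hys : |y| ≤ s := hgz ▸ le_max_right _ _
  -- The point avoids both sectors, so it lies on a lateral side of the square, at height below `s /
  -- 2` in absolute value.
  have hnot : 2 * |y| < |t| := by
    by_contra! hle
    rcases lt_trichotomy y 0 with hy | hy | hy
    · rw [abs_of_neg hy] at hle hys
      exact hdisj ⟨_, hlowmem t y hy (by linarith) hle, hzA⟩
    · rw [hy, abs_zero, mul_zero] at hle
      rw [hy, abs_zero, max_eq_left (abs_nonneg t)] at hgz
      linarith
    · rw [abs_of_pos hy] at hle hys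
      exact hup ⟨(t, y), ⟨hy, by simp only; linarith, hle⟩, rfl⟩ (hA.subset hzA)
  have ht : |t| = s := by
    rw [← hgz]; exact (max_eq_left (by linarith [abs_nonneg y])).symm
  have hy2 := abs_lt.1 (show |y| < s / 2 by linarith)
  -- Heights `±3s/4` lie beyond `y`, inside the square, and within the sectors because `s ≤ 2 ·
  -- 3s/4`.
  have hbot : frame x e ν (t, -(3 * s / 4)) ∈ frame x e (-ν) '' sector R :=
    hlowmem _ _ (by linarith) (by linarith) (by linarith)
  have htop : frame x e ν (t, 3 * s / 4) ∉ Ω :=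
    hup ⟨(t, 3 * s / 4), ⟨by simp only; linarith, by simp only; linarith, by simp only; linarith⟩, rfl⟩
  obtain ⟨b₂, hb₂, hf₂⟩ := exists_frontier_on_segment (x := x) (e := e) (ν := ν) (Ω := Ω) (t := t)
    (u := y) (v := 3 * s / 4) (by linarith) (Or.inl ⟨hA.subset hzA, htop⟩)
  -- A segment inside `Ω` from the inner sector up to the point of `A` would make the sector meet
  -- `A`; hence it leaves `Ω` on the way.
  obtain ⟨q, hq, hqΩ⟩ : ∃ q ∈ Set.Icc (-(3 * s / 4)) y, frame x e ν (t, q) ∉ Ω := by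
    by_contra! hall
    have hpre : IsPreconnected ((fun b => frame x e ν (t, b)) '' Set.Icc (-(3 * s / 4)) y) :=
      isPreconnected_Icc.image _ (continuous_frame.comp (by fun_prop)).continuousOn
    have hsub := hA.subset_of_inter_nonempty hpre (by rintro _ ⟨b, hb, rfl⟩; exact hall b hb)
      ⟨_, ⟨y, ⟨by linarith, le_rfl⟩, rfl⟩, hzA⟩
    exact hdisj ⟨_, hbot, hsub ⟨_, ⟨le_rfl, by linarith⟩, rfl⟩⟩
  have hqy : q < y := lt_of_le_of_ne hq.2 fun h => hqΩ (h ▸ hA.subset hzA)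
  obtain ⟨b₁, hb₁, hf₁⟩ := exists_frontier_on_segment (x := x) (e := e) (ν := ν) (Ω := Ω) (t := t)
    (u := -(3 * s / 4)) (v := q) hq.1 (Or.inl ⟨hlow hbot, hqΩ⟩)
  exact ⟨t, ht, b₁, b₂, by linarith [hb₁.2, hb₂.1], abs_le.2 ⟨by linarith [hb₁.1], by linarith [hb₁.2]⟩,
    abs_le.2 ⟨by linarith [hb₂.1], by linarith [hb₂.2]⟩, hf₁, hf₂⟩

/-! ### Contradiction from column counting, and lower density from Ahlfors regularity -/

/-- Vertical lines near a point of the reduced boundary cannot all meet the boundary twice. -/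
lemma IsReducedPoint.not_forall_two_frontier_points [IsFiniteMeasure τ]
    (h : IsReducedPoint G τ x ν θ) (hG : MeasurableSet G) (hv : VariationBound G τ)
    (he : Orthonormal ℝ ![e, ν]) {N Γ : Set Plane} (hN : Measure.hausdorffMeasure 1 N = 0)
    (hΓ : ∀ z ∈ Γ, z ∉ N → ∃ ν' θ', IsReducedPoint G τ z ν' θ')
    {ρ : ℝ} (hρ : 0 < ρ) :
    ¬ ∀ s, 0 < s → s < ρ → ∃ t, |t| = s ∧ ∃ b₁ b₂ : ℝ, b₁ < b₂ ∧ |b₁| ≤ s ∧ |b₂| ≤ s ∧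
      frame x e ν (t, b₁) ∈ Γ ∧ frame x e ν (t, b₂) ∈ Γ := by
  intro hall
  obtain ⟨K, hK, hcol⟩ := exists_volume_columns_le
  obtain ⟨σ, _, f1, f2, f3, r₀, hr₀, hσ⟩ := h.exists_small_flux hG he (ε := 1 / (16 * K))
    (by positivity)
  obtain ⟨R, hR, hRlt⟩ := exists_between (show 0 < min ρ (r₀ / 4) by positivity)
  obtain ⟨l1, l2⟩ := lt_min_iff.1 hRlt
  have hS := hcol G τ σ x e ν R hG inferInstance hv inferInstance f1 f2 f3 he hR
  set S := {s : ℝ | |s| ≤ R ∧ ∃ b₁ b₂ : ℝ, b₁ < b₂ ∧ |b₁| ≤ R ∧ |b₂| ≤ R ∧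
      (∃ ν' θ', IsReducedPoint G τ (frame x e ν (s, b₁)) ν' θ') ∧
      (∃ ν' θ', IsReducedPoint G τ (frame x e ν (s, b₂)) ν' θ')} with hSdef
  -- The projection is `1`-Lipschitz, so the exceptional boundary points spoil only a null set of
  -- columns.
  have hZ : volume ((fun z : Plane => (inner ℝ e (z - x) : ℝ)) '' N) = 0 := by
    rw [← MeasureTheory.hausdorffMeasure_real]
    have hlip : LipschitzWith 1 (fun z : Plane => (inner ℝ e (z - x) : ℝ)) := by
      refine LipschitzWith.of_dist_le_mul fun z w => ?_
      rw [Real.dist_eq, ← inner_sub_right, sub_sub_sub_cancel_right, NNReal.coe_one, one_mul,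
        dist_eq_norm]
      refine (abs_real_inner_le_norm _ _).trans ?_
      have : ‖e‖ = 1 := by simpa using he.1 0
      rw [this, one_mul]
    have := hlip.hausdorffMeasure_image_le (d := 1) (by norm_num) N
    rw [hN, mul_zero] at this
    exact le_antisymm this zero_le
  set W := S ∪ (fun z : Plane => (inner ℝ e (z - x) : ℝ)) '' N with hW
  -- Only `|t| = s` is known, so a reflection is needed and doubles the measure. The choice `ε = 1 /
  -- (16 K)` gives `W` measure at most `R / 4`, too small to cover `(0, R)`.
  have hcover : Set.Ioo 0 R ⊆ W ∪ Neg.neg ⁻¹' W := by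
    rintro s ⟨hs0, hsR⟩
    obtain ⟨t, ht, b₁, b₂, hb, hb₁, hb₂, hf₁, hf₂⟩ := hall s hs0 (hsR.trans l1)
    have htW : t ∈ W := by
      by_cases h1 : frame x e ν (t, b₁) ∈ N
      · exact Or.inr ⟨_, h1, inner_frame_fst he _⟩
      by_cases h2 : frame x e ν (t, b₂) ∈ N
      · exact Or.inr ⟨_, h2, inner_frame_fst he _⟩
      exact Or.inl ⟨by rw [ht]; exact hsR.le, b₁, b₂, hb, hb₁.trans hsR.le, hb₂.trans hsR.le,
        hΓ _ hf₁ h1, hΓ _ hf₂ h2⟩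
    rcases abs_eq hs0.le |>.1 ht with h1 | h1
    · exact Or.inl (h1 ▸ htW)
    · right; rw [Set.mem_preimage, ← h1]; exact htW
  have hWv : volume W ≤ volume S := (measure_union_le _ _).trans (by rw [hZ, add_zero])
  have hσ4 : σ (Metric.ball x (4 * R)) ≤ ENNReal.ofReal (R / (4 * K)) := by
    rw [← ENNReal.ofReal_toReal (measure_ne_top σ _)]
    apply ENNReal.ofReal_le_ofReal
    have := hσ (4 * R) (by positivity) (by linarith)
    rw [measureReal_def] at this
    refine this.trans (le_of_eq ?_)
    field_simp
    norm_num
  have hfin : ENNReal.ofReal R ≤ ENNReal.ofReal (R / 2) := by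
    calc ENNReal.ofReal R = volume (Set.Ioo 0 R) := by simp
      _ ≤ volume W + volume (Neg.neg ⁻¹' W) := (measure_mono hcover).trans (measure_union_le _ _)
      _ = 2 * volume W := by rw [Measure.measure_preimage_neg, two_mul]
      _ ≤ 2 * (ENNReal.ofReal K * ENNReal.ofReal (R / (4 * K))) := by
          gcongr
          exact hWv.trans (hS.trans (by gcongr))
      _ = ENNReal.ofReal (R / 2) := by
          rw [← ENNReal.ofReal_mul hK.le, ← ENNReal.ofReal_ofNat, ← ENNReal.ofReal_mul (by norm_num)]
          congr 1
          field_simp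
          norm_num
  rw [ENNReal.ofReal_le_ofReal_iff (by positivity)] at hfin
  linarith

end

/-- Lower Ahlfors regularity of the boundary gives a lower density bound for the variation. -/
lemma exists_le_measure_ball_of_ahlfors {G Γ N : Set Plane} {τ : Measure Plane} [IsFiniteMeasure τ]
    (hG : MeasurableSet G) (hv : VariationBound G τ) (hΓ : IsLowerAhlforsRegular Γ)
    (hN : Measure.hausdorffMeasure 1 (Γ ∩ N) = 0)
    (hred : ∀ z ∈ Γ, z ∉ N → ∃ ν θ, IsReducedPoint G τ z ν θ) :
    ∃ C > (0:ℝ), ∃ r₀ > (0:ℝ), ∀ z ∈ Γ, ∀ r, 0 < r → r < r₀ → C * r ≤ τ.real (Metric.ball z r) := by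
  obtain ⟨r₀, hr₀, C, hC, hA⟩ := hΓ
  obtain ⟨c, hc, hd⟩ := exists_density_estimates
  refine ⟨C * c / 10, by positivity, r₀, hr₀, fun z hz r hr hrr => ?_⟩
  have h1 := hA r ⟨hr, hrr⟩ z hz
  -- Off `N` every point of `Γ` is a reduced boundary point, with universal lower density `c`; the
  -- covering lemma then bounds length by variation, so large length forces large variation.
  have h2 : Measure.hausdorffMeasure 1 ((Γ \ N) ∩ Metric.ball z r) ≤
      ENNReal.ofReal (10 / c) * τ (Metric.ball z r) := by
    refine hausdorffMeasure_le_of_density τ hc ?_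
    rintro w ⟨⟨hwΓ, hwN⟩, hwb⟩ ε hε
    obtain ⟨ν, θ, hw⟩ := hred w hwΓ hwN
    obtain ⟨r₁, hr₁, hd⟩ := hd G τ θ w ν hG inferInstance hv hw
    rw [Metric.mem_ball] at hwb
    obtain ⟨ρ, hρ, hρlt⟩ := exists_between (show 0 < min r₁ (min ε (r - dist w z)) by
      have : 0 < r - dist w z := by linarith
      positivity)
    simp only [lt_min_iff] at hρlt
    refine ⟨ρ, hρ, hρlt.2.1, ?_, ?_⟩
    · exact Metric.closedBall_subset_ball' (by linarith)
    · rw [ENNReal.ofReal_le_iff_le_toReal (measure_ne_top τ _)]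
      exact (hd ρ hρ hρlt.1).2.2.trans (measureReal_mono Metric.ball_subset_closedBall)
  have h3 : Measure.hausdorffMeasure 1 (Γ ∩ Metric.ball z r) ≤
      ENNReal.ofReal (10 / c) * τ (Metric.ball z r) := by
    calc _ ≤ Measure.hausdorffMeasure 1 (((Γ \ N) ∩ Metric.ball z r) ∪ (Γ ∩ N)) := by
          refine measure_mono fun w hw => ?_
          by_cases hwN : w ∈ N
          · exact Or.inr ⟨hw.1, hwN⟩
          · exact Or.inl ⟨⟨hw.1, hwN⟩, hw.2⟩
      _ ≤ _ := (measure_union_le _ _).trans (by rw [hN, add_zero]; exact h2)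
  have h4 := h1.trans h3
  rw [ENNReal.ofReal_le_iff_le_toReal (by finiteness), ENNReal.toReal_mul,
    ENNReal.toReal_ofReal (by positivity)] at h4
  rw [measureReal_def]
  have h5 : C * r * c ≤ 10 / c * (τ (Metric.ball z r)).toReal * c := by gcongr
  have h6 : 10 / c * (τ (Metric.ball z r)).toReal * c = 10 * (τ (Metric.ball z r)).toReal := by
    field_simp
  linarith

/-! ### Conclusion for components of `Ω` -/

theorem mainTheorem11 (Ω : Set (EuclideanSpace ℝ (Fin 2)))
    (hΩ : HasFinitePerimeter Ω)
    (hAhlfors : IsLowerAhlforsRegular (frontier Ω))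
    (hred : Measure.hausdorffMeasure 1 (frontier Ω \ reducedBoundary Ω) = 0)
    (A A' : Set (EuclideanSpace ℝ (Fin 2)))
    (hA : IsConnectedComponentOf A Ω) (hA' : IsConnectedComponentOf A' Ω) (hne : A ≠ A') :
    (∀ x₀ ∈ frontier A ∩ frontier A', x₀ ∉ reducedBoundary Ω) ∧
      Measure.hausdorffMeasure 1 (frontier A ∩ frontier A') = 0 := by
  have hμ : IsGaussGreenMeasure Ω (gaussGreenMeasure Ω) ∧
      (gaussGreenMeasure Ω).variation Set.univ < ⊤ := by
    rw [gaussGreenMeasure, dif_pos hΩ]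
    exact hΩ.2.choose_spec
  obtain ⟨hμ, hfin⟩ := hμ
  have : IsFiniteMeasure (gaussGreenMeasure Ω).variation := ⟨hfin⟩
  -- Measure-theoretic arguments use the measurable representative `G`, with the same Gauss–Green
  -- measure; frontiers and components remain those of `Ω`.
  obtain ⟨G, -, hG, hGΩ⟩ := hΩ.1.exists_measurable_superset_ae_eq
  have hμG := hμ.congr hGΩ
  have hv := variationBound_of_isGaussGreenMeasure hμG
  have hpt : ∀ z ∈ reducedBoundary Ω, ∃ ν θ,
      IsReducedPoint G (gaussGreenMeasure Ω).variation z ν θ := by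
    rintro z ⟨ν, hν, hlim⟩
    exact ⟨ν, exists_isReducedPoint hμG hν hlim⟩
  obtain ⟨C, hC, r₀, hr₀, hden⟩ := exists_le_measure_ball_of_ahlfors (N := (reducedBoundary Ω)ᶜ)
    hG hv hAhlfors hred fun z _ hz => hpt z (not_not.1 hz)
  have part1 : ∀ x₀ ∈ frontier A ∩ frontier A', x₀ ∉ reducedBoundary Ω := by
    rintro x ⟨hxA, hxA'⟩ hx
    obtain ⟨ν, θ, h⟩ := hpt x hx
    obtain ⟨e, he⟩ := exists_orthonormal_pair h.norm_eq
    obtain ⟨R₁, hR₁, hup⟩ := h.exists_sector_disjoint hG hv hGΩ he hC hr₀ hden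
    -- The outer sector of the complement is the inner sector of `Ω`.
    obtain ⟨R₂, hR₂, hlow⟩ := (h.compl hG).exists_sector_disjoint (Ω := Ωᶜ) hG.compl (hv.compl hG)
      hGΩ.compl he.pair_neg hC hr₀ (by rwa [frontier_compl])
    rw [compl_compl] at hlow
    have hmono : ∀ R R' : ℝ, R ≤ R' → sector R ⊆ sector R' := fun R R' hRR p hp =>
      ⟨hp.1, hp.2.1.trans_le hRR, hp.2.2⟩
    set R := min R₁ R₂ with hR
    have hR0 : 0 < R := lt_min hR₁ hR₂
    have hup' := (Set.image_mono (f := frame x e ν) (hmono R R₁ (min_le_left _ _))).trans hup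
    have hlow' := (Set.image_mono (f := frame x e (-ν)) (hmono R R₂ (min_le_right _ _))).trans hlow
    have hpre := isPreconnected_frame_sector x e (-ν) R
    have key : ∀ B, IsConnectedComponentOf B Ω → x ∈ frontier B →
        (frame x e (-ν) '' sector R ∩ B).Nonempty := by
      intro B hB hxB
      by_contra hno
      obtain ⟨ρ, hρ, h2⟩ := exists_two_frontier_points he hR0 hup' hlow' hB
        (frontier_subset_closure hxB) hno
      refine h.not_forall_two_frontier_points hG hv he (Γ := frontier Ω) hred (fun z hz hzN => ?_)
        hρ h2
      exact hpt z (by_contra fun hzr => hzN ⟨hz, hzr⟩)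
    -- The inner sector is a connected subset of `Ω` meeting both components, so they coincide.
    have s1 := hA.subset_of_inter_nonempty hpre hlow' (key A hA hxA)
    obtain ⟨w, hw, hwA'⟩ := key A' hA' hxA'
    exact hne (hA.eq_of_inter_nonempty hA' ⟨w, s1 hw, hwA'⟩)
  refine ⟨part1, measure_mono_null (t := frontier Ω \ reducedBoundary Ω) (fun z hz => ?_) hred⟩
  refine ⟨⟨?_, fun hzi => ?_⟩, part1 z hz⟩
  · exact closure_mono hA.subset (frontier_subset_closure hz.1)
  -- At an interior point of `Ω`, a ball inside `Ω` would meet both components and join them.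
  · obtain ⟨r, hr, hball⟩ := Metric.isOpen_iff.1 isOpen_interior z hzi
    have hpre : IsPreconnected (Metric.ball z r) := (convex_ball z r).isPreconnected
    have hmeet : ∀ B, z ∈ frontier B → (Metric.ball z r ∩ B).Nonempty := fun B hB =>
      mem_closure_iff_nhds.1 (frontier_subset_closure hB) _ (Metric.ball_mem_nhds z hr)
    have s1 := hA.subset_of_inter_nonempty hpre (hball.trans interior_subset) (hmeet A hz.1)
    obtain ⟨w, hw, hwA'⟩ := hmeet A' hz.2
    exact hne (hA.eq_of_inter_nonempty hA' ⟨w, s1 hw, hwA'⟩)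

end
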